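/- Consider the state space model $x_{t+1}=Ax_t+\epsilon_t$, $y_t=Cx_t+\varepsilon_t$ with $x_t\in\mathbb R^n$, $y_t\in\mathbb R^m$, independent white Gaussian noises $\epsilon_t\sim\mathcal N(0,Q)$, $\varepsilon_t\sim\mathcal N(0,R)$, and initial state $x_0\sim\mathcal N(\hat x_0,P_0)$ independent of the noises, where $Q,R,P_0>0$. Let $\psi_t(y_t|x_t)$ be the nominal observation density $\mathcal N(Cx_t,R)$ and $p_t(x_{t+1}|x_t)$ the transition density $\mathcal N(Ax_t,Q)$. Write $Y_t=(y_0,\dots,y_t)$, and fix $\theta>0$ and a horizon $N\ge 0$. Starting from $\tilde p_0(x_0|Y_{-1})=\mathcal N(\hat x_0,P_0)$, at each time $t\in\{0,\dots,N\}$, given the a priori density $\tilde p_t(x_t|Y_{t-1})$, the observation density and the update estimator are obtained from the penalized minimax problem $$(\tilde\psi_t^\star,g_t^\star)\in\arg\min_{g_t\in\mathcal G_t}\ \max_{\tilde\psi_t\in\bar{\mathcal B}_t}\ J_t(\tilde\psi_t,g_t)-\theta^{-1}\,\mathcal D(\tilde\psi_t,\psi_t),$$ $$J_t(\tilde\psi_t,g_t)=\tfrac12\iint\|x_t-g_t(y_t)\|^2\,\tilde\psi_t(y_t|x_t)\,\tilde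 p_t(x_t|Y_{t-1})\,dy_t\,dx_t,\qquad \mathcal D(\tilde\psi_t,\psi_t)=\iint\tilde\psi_t\,\tilde p_t(x_t|Y_{t-1})\ln\frac{\tilde\psi_t}{\psi_t}\,dy_t\,dx_t .$$ Here $\bar{\mathcal B}_t$ is the set of nonnegative measurable functions $\tilde\psi_t(y_t|x_t)$ with $\iint\tilde\psi_t\,\tilde p_t(x_t|Y_{t-1})\,dy_t\,dx_t=1$ and $\mathcal D(\tilde\psi_t,\psi_t)<\infty$ (only this joint normalization is imposed), and $\mathcal G_t$ is the set of measurable estimators with finite second moments under $\tilde\psi_t\,\tilde p_t(x_t|Y_{t-1})$ for every $\tilde\psi_t\in\bar{\mathcal B}_t$. That $(\tilde\psi_t^\star,g_t^\star)$ solves the problem means that $\tilde\psi^\star_t$ attains the maximum against $g_t^\star$, and that $g_t^\star$ minimizes the maximum (supremum). The solutions are required to depend measurably on $Y_{t-1}$ and to solve the problem for almost every $Y_{t-1}$. Then $\tilde p_t(x_t|Y_t)\propto\tilde\psi_t^\star(y_t|x_t)\,\tilde p_t(x_t|Y_{t-1})$ is the a posteriori density, and $\tilde p_{t+1}(x_{t+1}|Y_t)=\int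 p_t(x_{t+1}|x_t)\,\tilde p_t(x_t|Y_t)\,dx_t$ is the next a priori density. Define, starting from $\hat x_0$ and $P_0$, $$L_t=P_tC^\top(CP_tC^\top+R)^{-1},\quad \hat x_{t|t}=\hat x_t+L_t(y_t-C\hat x_t),\quad P_{t|t}=(I-L_tC)P_t,\quad V_{t|t}=(P_{t|t}^{-1}-\theta I)^{-1},$$ $$\hat x_{t+1}=A\hat x_{t|t},\qquad P_{t+1}=AV_{t|t}A^\top+Q .$$ Theorem. The minimax problems for $t=0,\dots,N$ have a solution if and only if $\theta\,\sigma_{\max}(P_{t|t})<1$ for all $t\le N$, where $\sigma_{\max}$ is the largest eigenvalue. For every solution, all $t\le N$ and almost every $Y_t$: the update estimate is $g_t^\star(y_t)=\hat x_{t|t}$; the matrices $P_t,P_{t|t},V_{t|t},P_{t+1}$ are positive definite; the a posteriori density $\tilde p_t(x_t|Y_t)$ is that of $\mathcal N(\hat x_{t|t},V_{t|t})$, and $V_{t|t}$ is the covariance matrix of the estimation error $x_t-\hat x_{t|t}$, both given $Y_t$ and given $Y_{t-1}$, under the least favorable density; and $\tilde p_{t+1}(x_{t+1}|Y_t)$ is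 the density of $\mathcal N(\hat x_{t+1},P_{t+1})$, so that the predictor of $x_{t+1}$ given $Y_t$ is $\hat x_{t+1}=A\hat x_{t|t}$, with prediction error covariance matrix $P_{t+1}=AV_{t|t}A^\top+Q$. -/

import Mathlib

open MeasureTheory
open scoped Matrix

namespace RiskSensitive

noncomputable section

/-- The density of the Gaussian law `N(μ, S)` on `ℝᵏ`, for a positive definite covariance `S`. -/
def gaussianDensity {k : ℕ} (μ : Fin k → ℝ) (S : Matrix (Fin k) (Fin k) ℝ) (x : Fin k → ℝ) : ℝ :=
  (Real.sqrt ((2 * Real.pi) ^ k * S.det))⁻¹ *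
    Real.exp (-(1 / 2) * ((x - μ) ⬝ᵥ (S⁻¹ *ᵥ (x - μ))))

/-- The mean vector `∫ x ρ(x) dx` of a density. -/
def densityMean {k : ℕ} (ρ : (Fin k → ℝ) → ℝ) : Fin k → ℝ :=
  fun i => ∫ x, x i * ρ x

/-- The second moment matrix `∫ (x - μ)(x - μ)ᵀ ρ(x) dx` of a density about the point `μ`. -/
def densityCov {k : ℕ} (ρ : (Fin k → ℝ) → ℝ) (μ : Fin k → ℝ) : Matrix (Fin k) (Fin k) ℝ :=
  Matrix.of fun i j => ∫ x, (x i - μ i) * (x j - μ j) * ρ x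

/-- The largest eigenvalue of a symmetric real matrix (`0` for the empty matrix). -/
def sigmaMax {k : ℕ} (S : Matrix (Fin k) (Fin k) ℝ) : ℝ := sSup (spectrum ℝ S)

/-- The linear Gaussian state space model `x_{t+1} = A x_t + ε_t`, `y_t = C x_t + ε'_t` with
independent white noises of covariances `Q` and `R`, and `x_0 ∼ N(x0, P0)`. -/
structure Model (n m : ℕ) where
  A : Matrix (Fin n) (Fin n) ℝ
  Q : Matrix (Fin n) (Fin n) ℝ
  C : Matrix (Fin m) (Fin n) ℝ
  R : Matrix (Fin m) (Fin m) ℝ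
  x0 : Fin n → ℝ
  P0 : Matrix (Fin n) (Fin n) ℝ
  posDef_Q : Q.PosDef
  posDef_R : R.PosDef
  posDef_P0 : P0.PosDef

variable {n m : ℕ}

namespace Model

/-- The transition density `p(x' | x)`, that of `N(A x, Q)`. -/
def transition (S : Model n m) (x x' : Fin n → ℝ) : ℝ := gaussianDensity (S.A *ᵥ x) S.Q x'

/-- The nominal observation density `ψ(y | x)`, that of `N(C x, R)`. -/
def nominalObs (S : Model n m) (x : Fin n → ℝ) (y : Fin m → ℝ) : ℝ :=
  gaussianDensity (S.C *ᵥ x) S.R y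

/-! ### The penalized game at one time step

`ρ` is the a priori density of `x_t` given the past observations; a candidate observation density
`φ x y` stands for `φ(y | x)`. -/

/-- The observation densities available to the maximizer: nonnegative measurable functions `φ`
such that `φ(y | x) ρ(x)` is a probability density of `(x_t, y_t)`, of finite divergence from the
nominal one.  The normalization is that of the joint density. -/
structure IsObsDensity (S : Model n m) (ρ : (Fin n → ℝ) → ℝ)
    (φ : (Fin n → ℝ) → (Fin m → ℝ) → ℝ) : Prop where
  measurable : Measurable fun w : (Fin n → ℝ) × (Fin m → ℝ) => φ w.1 w.2
  nonneg : ∀ x y, 0 ≤ φ x y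
  integrable : Integrable fun w : (Fin n → ℝ) × (Fin m → ℝ) => φ w.1 w.2 * ρ w.1
  mass : ∫ w : (Fin n → ℝ) × (Fin m → ℝ), φ w.1 w.2 * ρ w.1 = 1
  finite_div : Integrable fun w : (Fin n → ℝ) × (Fin m → ℝ) =>
    φ w.1 w.2 * ρ w.1 * Real.log (φ w.1 w.2 / S.nominalObs w.1 w.2)

/-- The estimators with finite second moments under all the densities `φ(y | x) ρ(x)`. -/
structure IsEstimator (S : Model n m) (ρ : (Fin n → ℝ) → ℝ)
    (g : (Fin m → ℝ) → (Fin n → ℝ)) : Prop where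
  measurable : Measurable g
  finite_moment : ∀ φ, S.IsObsDensity ρ φ →
    Integrable fun w : (Fin n → ℝ) × (Fin m → ℝ) => (g w.2 ⬝ᵥ g w.2) * (φ w.1 w.2 * ρ w.1)

/-- The Kullback-Leibler divergence `D(φ, ψ)` given the past observations. -/
def divergence (S : Model n m) (ρ : (Fin n → ℝ) → ℝ)
    (φ : (Fin n → ℝ) → (Fin m → ℝ) → ℝ) : ℝ :=
  ∫ w : (Fin n → ℝ) × (Fin m → ℝ),
    φ w.1 w.2 * ρ w.1 * Real.log (φ w.1 w.2 / S.nominalObs w.1 w.2)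

end Model

/-- The mean square error `J(φ, g) = ½ E[‖x_t - g(y_t)‖²]` given the past observations. -/
def meanSquareError (ρ : (Fin n → ℝ) → ℝ)
    (φ : (Fin n → ℝ) → (Fin m → ℝ) → ℝ) (g : (Fin m → ℝ) → (Fin n → ℝ)) : ℝ :=
  1 / 2 * ∫ w : (Fin n → ℝ) × (Fin m → ℝ),
    ((w.1 - g w.2) ⬝ᵥ (w.1 - g w.2)) * (φ w.1 w.2 * ρ w.1)

/-- The covariance `E[(x_t - g(y_t)) (x_t - g(y_t))ᵀ]` of the estimation error given the past
observations, under the joint density `φ(y | x) ρ(x)`. -/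
def errorCov (ρ : (Fin n → ℝ) → ℝ)
    (φ : (Fin n → ℝ) → (Fin m → ℝ) → ℝ) (g : (Fin m → ℝ) → (Fin n → ℝ)) :
    Matrix (Fin n) (Fin n) ℝ :=
  Matrix.of fun i j => ∫ w : (Fin n → ℝ) × (Fin m → ℝ),
    (w.1 i - g w.2 i) * (w.1 j - g w.2 j) * (φ w.1 w.2 * ρ w.1)

/-- The a posteriori density of `x_t` given also `y_t = y`. -/
def posterior (ρ : (Fin n → ℝ) → ℝ) (φ : (Fin n → ℝ) → (Fin m → ℝ) → ℝ) (y : Fin m → ℝ) :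
    (Fin n → ℝ) → ℝ :=
  fun x => φ x y * ρ x / ∫ z, φ z y * ρ z

namespace Model

/-- The payoff `J(φ, g) - θ⁻¹ D(φ, ψ)` of the penalized game. -/
def payoff (S : Model n m) (θ : ℝ) (ρ : (Fin n → ℝ) → ℝ)
    (φ : (Fin n → ℝ) → (Fin m → ℝ) → ℝ) (g : (Fin m → ℝ) → (Fin n → ℝ)) : ℝ :=
  meanSquareError ρ φ g - θ⁻¹ * S.divergence ρ φ

/-- The worst-case payoff of an estimator, possibly `+∞`. -/
def worstPayoff (S : Model n m) (θ : ℝ) (ρ : (Fin n → ℝ) → ℝ)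
    (g : (Fin m → ℝ) → (Fin n → ℝ)) : EReal :=
  ⨆ φ : {φ : (Fin n → ℝ) → (Fin m → ℝ) → ℝ // S.IsObsDensity ρ φ},
    ((S.payoff θ ρ φ.1 g : ℝ) : EReal)

/-- `(φ, g)` solves `arg min_g max_φ` of the payoff: `φ` attains the maximum against `g`, and `g`
minimizes the maximum over all estimators. -/
structure IsMinimaxSolution (S : Model n m) (θ : ℝ) (ρ : (Fin n → ℝ) → ℝ)
    (φ : (Fin n → ℝ) → (Fin m → ℝ) → ℝ) (g : (Fin m → ℝ) → (Fin n → ℝ)) : Prop where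
  obsDensity : S.IsObsDensity ρ φ
  estimator : S.IsEstimator ρ g
  maximal : ∀ φ', S.IsObsDensity ρ φ' → S.payoff θ ρ φ' g ≤ S.payoff θ ρ φ g
  minimal : ∀ g', S.IsEstimator ρ g' → S.worstPayoff θ ρ g ≤ S.worstPayoff θ ρ g'

/-! ### The dynamic game

A history at time `t` is the tuple `(y_0, …, y_{t-1})`; the least favorable observation density
`ψ t h` and the estimator `g t h` used at time `t` may depend on it. -/

/-- The a priori density of `x_t` given `(y_0, …, y_{t-1}) = h`, when the observation densities
are `ψ`: a Bayes update with `ψ`, followed by a prediction step with the transition density. -/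
def prior (S : Model n m)
    (ψ : (t : ℕ) → (Fin t → Fin m → ℝ) → (Fin n → ℝ) → (Fin m → ℝ) → ℝ) :
    (t : ℕ) → (Fin t → Fin m → ℝ) → (Fin n → ℝ) → ℝ
  | 0, _ => gaussianDensity S.x0 S.P0
  | t + 1, h => fun x' => ∫ x, S.transition x x' *
      posterior (S.prior ψ t (Fin.init h)) (ψ t (Fin.init h)) (h (Fin.last t)) x

/-- `ψ` and `g` solve the penalized minimax problem at all times `0, …, N`, for almost all
observed histories. -/
structure IsRiskSensitiveSolution (S : Model n m) (θ : ℝ) (N : ℕ)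
    (ψ : (t : ℕ) → (Fin t → Fin m → ℝ) → (Fin n → ℝ) → (Fin m → ℝ) → ℝ)
    (g : (t : ℕ) → (Fin t → Fin m → ℝ) → (Fin m → ℝ) → (Fin n → ℝ)) : Prop where
  measurable_obs : ∀ t ≤ N, Measurable
    fun p : (Fin t → Fin m → ℝ) × (Fin n → ℝ) × (Fin m → ℝ) => ψ t p.1 p.2.1 p.2.2
  measurable_est : ∀ t ≤ N, Measurable
    fun p : (Fin t → Fin m → ℝ) × (Fin m → ℝ) => g t p.1 p.2
  minimax : ∀ t ≤ N, ∀ᵐ h : Fin t → Fin m → ℝ,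
    S.IsMinimaxSolution θ (S.prior ψ t h) (ψ t h) (g t h)

/-! ### The filter recursion -/

/-- The filtering gain `L = P Cᵀ (C P Cᵀ + R)⁻¹`. -/
def gain (S : Model n m) (P : Matrix (Fin n) (Fin n) ℝ) : Matrix (Fin n) (Fin m) ℝ :=
  P * S.Cᵀ * (S.C * P * S.Cᵀ + S.R)⁻¹

/-- `P_{t|t} = (I - L C) P_t`. -/
def filtCov (S : Model n m) (P : Matrix (Fin n) (Fin n) ℝ) : Matrix (Fin n) (Fin n) ℝ :=
  (1 - S.gain P * S.C) * P

/-- `V_{t|t} = (P_{t|t}⁻¹ - θ I)⁻¹`. -/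
def riskCov (S : Model n m) (θ : ℝ) (P : Matrix (Fin n) (Fin n) ℝ) : Matrix (Fin n) (Fin n) ℝ :=
  ((S.filtCov P)⁻¹ - θ • (1 : Matrix (Fin n) (Fin n) ℝ))⁻¹

/-- `P_t`, given by `P_{t+1} = A V_{t|t} Aᵀ + Q`. -/
def predCov (S : Model n m) (θ : ℝ) : ℕ → Matrix (Fin n) (Fin n) ℝ
  | 0 => S.P0
  | t + 1 => S.A * S.riskCov θ (S.predCov θ t) * S.Aᵀ + S.Q

/-- The update `x̂ + L (y - C x̂)` of the prediction `x̂`. -/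
def update (S : Model n m) (P : Matrix (Fin n) (Fin n) ℝ) (x : Fin n → ℝ) (y : Fin m → ℝ) :
    Fin n → ℝ :=
  x + S.gain P *ᵥ (y - S.C *ᵥ x)

/-- `x̂_t` as a function of `(y_0, …, y_{t-1})`, given by `x̂_{t+1} = A x̂_{t|t}`. -/
def predMean (S : Model n m) (θ : ℝ) : (t : ℕ) → (Fin t → Fin m → ℝ) → Fin n → ℝ
  | 0, _ => S.x0
  | t + 1, h => S.A *ᵥ
      S.update (S.predCov θ t) (S.predMean θ t (Fin.init h)) (h (Fin.last t))

/-- `x̂_{t|t} = x̂_t + L_t (y_t - C x̂_t)` as a function of `(y_0, …, y_t)`. -/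
def filtMean (S : Model n m) (θ : ℝ) (t : ℕ) (h : Fin (t + 1) → Fin m → ℝ) : Fin n → ℝ :=
  S.update (S.predCov θ t) (S.predMean θ t (Fin.init h)) (h (Fin.last t))

end Model

end

end RiskSensitive

/-! Write F = φρ for the joint density of (x_t, y_t), q for the nominal one, and a = (θ/2)‖x -
g(y)‖². Then θ times the payoff is ∫ aF - ∫ F log(F/q). Only the joint mass is constrained, so F
runs over all probability densities of finite entropy relative to q, and the Gibbs variational
principle gives the supremum log ∫ q eᵃ. The game is therefore the minimization over g of the
exponential cost ∫ q eᵃ.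

For a Gaussian prior, Bayes' rule (`Model.nominalObs_mul_gaussianDensity`) factors q into the law of
y_t and N(x̂, W) with x̂ = x̂_{t|t}, W = P_{t|t}. By symmetry of the Gaussian and cosh ≥ 1,
displacing g(y) by d from x̂ multiplies the exponential moment by at least exp(θ‖d‖²/2)
(`le_lintegral_exp_mul_gaussianDensity`). Hence, if W⁻¹ - θI is positive definite, x̂ is the almost
everywhere unique minimizer, and the equality case of Gibbs identifies the worst joint density: it
keeps the law of y_t and gives x_t the conditional law N(x̂, (W⁻¹ - θI)⁻¹).

If θ σ_max(W) ≥ 1, the same bound at η < 1/σ_max(W) blows up as η → 1/σ_max(W), so every estimator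
has infinite cost, whereas an attained maximum would make it finite
(`Model.sigmaMax_lt_of_lintegral_le`).

Induction on time (`Model.IsRiskSensitiveSolution.prior_ae_eq`) propagates the Gaussian form:
uniqueness fixes the posterior up to null sets, and the prediction step preserves Gaussian laws.
Conversely, the explicit tilted densities `Model.worstObs` solve the game at every step. -/

namespace RiskSensitive

/-! ### Gaussian densities: reduction to the standard one, and moments. -/

section Gaussian

variable {k : ℕ}

theorem exists_factor_of_posDef {S : Matrix (Fin k) (Fin k) ℝ} (hS : S.PosDef) :
    ∃ B : Matrix (Fin k) (Fin k) ℝ, S = B * Bᵀ ∧ B.det ≠ 0 := by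
  open scoped MatrixOrder in
  obtain ⟨D, rfl⟩ := CStarAlgebra.nonneg_iff_eq_star_mul_self.mp hS.posSemidef.nonneg
  refine ⟨Dᵀ, ?_, ?_⟩
  · rw [Matrix.transpose_transpose, Matrix.star_eq_conjTranspose,
      Matrix.conjTranspose_eq_transpose_of_trivial]
  · have h := hS.det_pos
    rw [Matrix.det_mul] at h
    rw [Matrix.det_transpose]
    exact right_ne_zero_of_mul h.ne'

theorem measurableEmbedding_affine {B : Matrix (Fin k) (Fin k) ℝ} (hB : B.det ≠ 0)
    (μ : Fin k → ℝ) : MeasurableEmbedding fun z : Fin k → ℝ => μ + B *ᵥ z := by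
  refine Continuous.measurableEmbedding (by fun_prop) ?_
  intro x y h
  exact Matrix.mulVec_injective_iff_isUnit.mpr
    ((Matrix.isUnit_iff_isUnit_det _).mpr hB.isUnit) (add_left_cancel h)

theorem map_affine_volume {B : Matrix (Fin k) (Fin k) ℝ} (hB : B.det ≠ 0) (μ : Fin k → ℝ) :
    Measure.map (fun z : Fin k → ℝ => μ + B *ᵥ z) volume =
      ENNReal.ofReal |B.det⁻¹| • (volume : Measure (Fin k → ℝ)) := by
  have h1 : (fun z : Fin k → ℝ => μ + B *ᵥ z) = (fun x => μ + x) ∘ Matrix.toLin' B := by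
    ext z; simp
  have h2 : Measurable (Matrix.toLin' B) :=
    (LinearMap.continuous_of_finiteDimensional _).measurable
  rw [h1, ← Measure.map_map (by fun_prop) h2, Real.map_matrix_volume_pi_eq_smul_volume_pi hB,
    Measure.map_smul, map_add_left_eq_self]

theorem integral_comp_affine {B : Matrix (Fin k) (Fin k) ℝ} (hB : B.det ≠ 0) (μ : Fin k → ℝ)
    (f : (Fin k → ℝ) → ℝ) : ∫ z, f (μ + B *ᵥ z) = |B.det|⁻¹ * ∫ x, f x := by
  rw [← (measurableEmbedding_affine hB μ).integral_map f, map_affine_volume hB,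
    integral_smul_measure, ENNReal.toReal_ofReal (abs_nonneg _), abs_inv, smul_eq_mul]

theorem integrable_comp_affine_iff {B : Matrix (Fin k) (Fin k) ℝ} (hB : B.det ≠ 0)
    (μ : Fin k → ℝ) (f : (Fin k → ℝ) → ℝ) :
    Integrable (fun z => f (μ + B *ᵥ z)) ↔ Integrable f := by
  have h := (measurableEmbedding_affine hB μ).integrable_map_iff (g := f) (μ := volume)
  rw [map_affine_volume hB, integrable_smul_measure (by simpa using hB) ENNReal.ofReal_ne_top] at h
  exact h.symm

/-- The substitution x = μ + B z turns the quadratic form into ‖z‖², so the density splits into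
one-dimensional factors; |det B|⁻¹ later cancels the Jacobian. -/
theorem gaussianDensity_affine {B : Matrix (Fin k) (Fin k) ℝ} (hB : B.det ≠ 0)
    (μ z : Fin k → ℝ) : gaussianDensity μ (B * Bᵀ) (μ + B *ᵥ z) =
      |B.det|⁻¹ * ∏ i, ProbabilityTheory.gaussianPDFReal 0 1 (z i) := by
  have hu : IsUnit B.det := hB.isUnit
  have hut : IsUnit Bᵀ.det := by rwa [Matrix.det_transpose]
  have h1 : (B *ᵥ z) ⬝ᵥ ((B * Bᵀ)⁻¹ *ᵥ (B *ᵥ z)) = ∑ i, z i ^ 2 := by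
    rw [Matrix.mul_inv_rev, Matrix.mulVec_mulVec, Matrix.mul_assoc, Matrix.nonsing_inv_mul _ hu,
      Matrix.mul_one, Matrix.dotProduct_mulVec, ← Matrix.mulVec_transpose,
      Matrix.transpose_nonsing_inv, Matrix.transpose_transpose, Matrix.mulVec_mulVec,
      Matrix.nonsing_inv_mul _ hu, Matrix.one_mulVec]
    simp [dotProduct, sq]
  have h2 : ∏ i : Fin k, ProbabilityTheory.gaussianPDFReal 0 1 (z i) =
      (Real.sqrt (2 * Real.pi) ^ k)⁻¹ * Real.exp (-(1 / 2) * ∑ i, z i ^ 2) := by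
    simp only [ProbabilityTheory.gaussianPDFReal, Finset.prod_mul_distrib, Finset.prod_const,
      Finset.card_univ, Fintype.card_fin, ← Real.exp_sum, NNReal.coe_one, mul_one, sub_zero,
      inv_pow, Finset.mul_sum]
    congr 2
    refine Finset.sum_congr rfl fun i _ => by ring
  have h3 : Real.sqrt ((2 * Real.pi) ^ k * (B * Bᵀ).det) = Real.sqrt (2 * Real.pi) ^ k * |B.det| := by
    rw [Real.sqrt_mul (by positivity), Matrix.det_mul, Matrix.det_transpose, Real.sqrt_mul_self_eq_abs,
      Real.sqrt_eq_rpow, Real.sqrt_eq_rpow, ← Real.rpow_natCast, ← Real.rpow_mul (by positivity),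
      ← Real.rpow_natCast, ← Real.rpow_mul (by positivity), mul_comm (1 / 2 : ℝ)]
  rw [gaussianDensity, add_sub_cancel_left, h1, h2, h3, mul_inv]
  ring

theorem gaussianDensity_pos {S : Matrix (Fin k) (Fin k) ℝ} (hS : S.PosDef) (μ x : Fin k → ℝ) :
    0 < gaussianDensity μ S x := by
  have := hS.det_pos
  unfold gaussianDensity
  positivity

theorem integrable_mul_gaussianDensity_iff {B : Matrix (Fin k) (Fin k) ℝ} (hB : B.det ≠ 0)
    (μ : Fin k → ℝ) (f : (Fin k → ℝ) → ℝ) :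
    Integrable (fun x => f x * gaussianDensity μ (B * Bᵀ) x) ↔
      Integrable fun z => f (μ + B *ᵥ z) * ∏ i, ProbabilityTheory.gaussianPDFReal 0 1 (z i) := by
  rw [← integrable_comp_affine_iff hB μ]
  simp only [gaussianDensity_affine hB]
  have : (fun z => f (μ + B *ᵥ z) *
      (|B.det|⁻¹ * ∏ i, ProbabilityTheory.gaussianPDFReal 0 1 (z i))) =
      fun z => |B.det|⁻¹ * (f (μ + B *ᵥ z) * ∏ i, ProbabilityTheory.gaussianPDFReal 0 1 (z i)) := by
    ext z; ring
  rw [this, integrable_const_mul_iff (by simpa using hB)]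

theorem integral_mul_gaussianDensity {B : Matrix (Fin k) (Fin k) ℝ} (hB : B.det ≠ 0)
    (μ : Fin k → ℝ) (f : (Fin k → ℝ) → ℝ) :
    ∫ x, f x * gaussianDensity μ (B * Bᵀ) x =
      ∫ z, f (μ + B *ᵥ z) * ∏ i, ProbabilityTheory.gaussianPDFReal 0 1 (z i) := by
  have h := integral_comp_affine hB μ fun x => f x * gaussianDensity μ (B * Bᵀ) x
  have hd : |B.det| ≠ 0 := by simpa using hB
  rw [← mul_right_inj' (inv_ne_zero hd), ← h, ← integral_const_mul]
  simp only [gaussianDensity_affine hB]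
  refine integral_congr_ae (.of_forall fun z => ?_)
  simp only
  ring

/-! ### Moments -/

open ProbabilityTheory

theorem integrable_pow_mul_gaussianPDFReal (p : ℕ) :
    Integrable fun z : ℝ => z ^ p * gaussianPDFReal 0 1 z := by
  have h : MemLp id p (gaussianReal 0 1) := memLp_id_gaussianReal' p (by simp)
  have h2 := h.integrable_norm_pow' 
  rw [gaussianReal_of_var_ne_zero 0 one_ne_zero, integrable_withDensity_iff_integrable_smul₀'
    (by fun_prop) (by simp [gaussianPDF])] at h2
  refine h2.mono' (by fun_prop) (.of_forall fun z => ?_)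
  simp [toReal_gaussianPDF, abs_of_nonneg (gaussianPDFReal_nonneg 0 1 z), mul_comm]

theorem integral_id_mul_gaussianPDFReal : ∫ z : ℝ, z * gaussianPDFReal 0 1 z = 0 := by
  have h := integral_gaussianReal_eq_integral_smul (μ := 0) (v := 1) (f := fun z : ℝ => z)
    one_ne_zero
  rw [integral_id_gaussianReal] at h
  simpa [mul_comm] using h.symm

theorem integral_sq_mul_gaussianPDFReal : ∫ z : ℝ, z * z * gaussianPDFReal 0 1 z = 1 := by
  have h := integral_gaussianReal_eq_integral_smul (μ := 0) (v := 1) (f := fun z : ℝ => z * z)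
    one_ne_zero
  have h2 : variance (fun z : ℝ => z) (gaussianReal 0 1) = 1 := variance_fun_id_gaussianReal
  rw [variance_eq_integral (by fun_prop)] at h2
  simp only [integral_id_gaussianReal, sub_zero] at h2
  simp only [sq] at h2
  rw [h2] at h
  simpa [mul_comm, mul_assoc] using h.symm

theorem integrable_monomial_mul_prod_gaussianPDFReal (e : Fin k → ℕ) :
    Integrable fun z : Fin k → ℝ => (∏ i, z i ^ e i) * ∏ i, gaussianPDFReal 0 1 (z i) := by
  simp only [← Finset.prod_mul_distrib]
  exact Integrable.fintype_prod (f := fun i (z : ℝ) => z ^ e i * gaussianPDFReal 0 1 z)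
    fun i => integrable_pow_mul_gaussianPDFReal (e i)

theorem integral_monomial_mul_prod_gaussianPDFReal (e : Fin k → ℕ) :
    ∫ z : Fin k → ℝ, (∏ i, z i ^ e i) * ∏ i, gaussianPDFReal 0 1 (z i) =
      ∏ i, ∫ z : ℝ, z ^ e i * gaussianPDFReal 0 1 z := by
  simp only [← Finset.prod_mul_distrib]
  exact integral_fintype_prod_volume_eq_prod fun i (z : ℝ) => z ^ e i * gaussianPDFReal 0 1 z

theorem prod_pow_single (z : Fin k → ℝ) (i : Fin k) :
    ∏ l, z l ^ (Pi.single i 1 : Fin k → ℕ) l = z i := by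
  rw [Finset.prod_eq_single i] <;> simp +contextual

theorem prod_pow_single_add_single (z : Fin k → ℝ) (i j : Fin k) :
    ∏ l, z l ^ (Pi.single i 1 + Pi.single j 1 : Fin k → ℕ) l = z i * z j := by
  simp only [Pi.add_apply, pow_add, Finset.prod_mul_distrib, prod_pow_single]

theorem integrable_prod_gaussianPDFReal :
    Integrable fun z : Fin k → ℝ => ∏ i, gaussianPDFReal 0 1 (z i) := by
  simpa using integrable_monomial_mul_prod_gaussianPDFReal (k := k) 0

theorem integral_prod_gaussianPDFReal :
    ∫ z : Fin k → ℝ, ∏ i, gaussianPDFReal 0 1 (z i) = 1 := by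
  simpa [integral_gaussianPDFReal_eq_one] using
    integral_monomial_mul_prod_gaussianPDFReal (k := k) 0

theorem integrable_coord_mul_prod_gaussianPDFReal (i : Fin k) :
    Integrable fun z : Fin k → ℝ => z i * ∏ i, gaussianPDFReal 0 1 (z i) := by
  simpa only [prod_pow_single] using
    integrable_monomial_mul_prod_gaussianPDFReal (Pi.single i 1)

theorem integral_coord_mul_prod_gaussianPDFReal (i : Fin k) :
    ∫ z : Fin k → ℝ, z i * ∏ i, gaussianPDFReal 0 1 (z i) = 0 := by
  have h := integral_monomial_mul_prod_gaussianPDFReal (Pi.single i 1)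
  simp only [prod_pow_single] at h
  rw [h]
  refine Finset.prod_eq_zero (Finset.mem_univ i) ?_
  simpa using integral_id_mul_gaussianPDFReal

theorem integrable_coord_mul_coord_mul_prod_gaussianPDFReal (i j : Fin k) :
    Integrable fun z : Fin k → ℝ => z i * z j * ∏ i, gaussianPDFReal 0 1 (z i) := by
  have h := integrable_monomial_mul_prod_gaussianPDFReal (Pi.single i 1 + Pi.single j 1)
  simp only [prod_pow_single_add_single] at h
  exact h

theorem integral_coord_mul_coord_mul_prod_gaussianPDFReal (i j : Fin k) :
    ∫ z : Fin k → ℝ, z i * z j * ∏ i, gaussianPDFReal 0 1 (z i) = if i = j then 1 else 0 := by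
  have h := integral_monomial_mul_prod_gaussianPDFReal (Pi.single i 1 + Pi.single j 1)
  simp only [prod_pow_single_add_single] at h
  rw [h]
  split_ifs with hij
  · subst hij
    refine Finset.prod_eq_one fun l _ => ?_
    by_cases hl : l = i
    · subst hl
      simpa [pow_two] using integral_sq_mul_gaussianPDFReal
    · simp [hl, integral_gaussianPDFReal_eq_one]
  · refine Finset.prod_eq_zero (Finset.mem_univ i) ?_
    simpa [hij] using integral_id_mul_gaussianPDFReal

section Moments

variable {S : Matrix (Fin k) (Fin k) ℝ}

theorem integrable_gaussianDensity (hS : S.PosDef) (μ : Fin k → ℝ) :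
    Integrable (gaussianDensity μ S) := by
  obtain ⟨B, rfl, hB⟩ := exists_factor_of_posDef hS
  simpa using (integrable_mul_gaussianDensity_iff hB μ fun _ => 1).mpr
    (by simpa using integrable_prod_gaussianPDFReal)

theorem integral_gaussianDensity (hS : S.PosDef) (μ : Fin k → ℝ) :
    ∫ x, gaussianDensity μ S x = 1 := by
  obtain ⟨B, rfl, hB⟩ := exists_factor_of_posDef hS
  simpa [integral_prod_gaussianPDFReal] using integral_mul_gaussianDensity hB μ fun _ => 1

theorem integrable_sub_mul_gaussianDensity (hS : S.PosDef) (μ : Fin k → ℝ) (i : Fin k) :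
    Integrable fun x => (x i - μ i) * gaussianDensity μ S x := by
  obtain ⟨B, rfl, hB⟩ := exists_factor_of_posDef hS
  rw [integrable_mul_gaussianDensity_iff hB μ fun x => x i - μ i]
  simp only [Pi.add_apply, add_sub_cancel_left, Matrix.mulVec, dotProduct, Finset.sum_mul, mul_assoc]
  exact integrable_finsetSum _ fun a _ =>
    (integrable_coord_mul_prod_gaussianPDFReal a).const_mul _

theorem integral_sub_mul_gaussianDensity (hS : S.PosDef) (μ : Fin k → ℝ) (i : Fin k) :
    ∫ x, (x i - μ i) * gaussianDensity μ S x = 0 := by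
  obtain ⟨B, rfl, hB⟩ := exists_factor_of_posDef hS
  rw [integral_mul_gaussianDensity hB μ fun x => x i - μ i]
  simp only [Pi.add_apply, add_sub_cancel_left, Matrix.mulVec, dotProduct, Finset.sum_mul, mul_assoc]
  rw [integral_finsetSum _ fun a _ =>
    (integrable_coord_mul_prod_gaussianPDFReal a).const_mul _]
  simp [integral_const_mul, integral_coord_mul_prod_gaussianPDFReal]

theorem mulVec_mul_mulVec_mul (B : Matrix (Fin k) (Fin k) ℝ) (z : Fin k → ℝ) (i j : Fin k) (c : ℝ) :
    (B *ᵥ z) i * (B *ᵥ z) j * c = ∑ a, ∑ b, B i a * B j b * (z a * z b * c) := by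
  simp only [Matrix.mulVec, dotProduct]
  rw [Finset.sum_mul_sum, Finset.sum_mul]
  simp only [Finset.sum_mul]
  exact Finset.sum_congr rfl fun a _ => Finset.sum_congr rfl fun b _ => by ring

theorem integrable_sub_mul_sub_mul_gaussianDensity (hS : S.PosDef) (μ : Fin k → ℝ) (i j : Fin k) :
    Integrable fun x => (x i - μ i) * (x j - μ j) * gaussianDensity μ S x := by
  obtain ⟨B, rfl, hB⟩ := exists_factor_of_posDef hS
  rw [integrable_mul_gaussianDensity_iff hB μ fun x => (x i - μ i) * (x j - μ j)]
  simp only [Pi.add_apply, add_sub_cancel_left, mulVec_mul_mulVec_mul]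
  exact integrable_finsetSum _ fun a _ => integrable_finsetSum _ fun b _ =>
    (integrable_coord_mul_coord_mul_prod_gaussianPDFReal a b).const_mul _

theorem integral_sub_mul_sub_mul_gaussianDensity (hS : S.PosDef) (μ : Fin k → ℝ) (i j : Fin k) :
    ∫ x, (x i - μ i) * (x j - μ j) * gaussianDensity μ S x = S i j := by
  obtain ⟨B, rfl, hB⟩ := exists_factor_of_posDef hS
  rw [integral_mul_gaussianDensity hB μ fun x => (x i - μ i) * (x j - μ j)]
  simp only [Pi.add_apply, add_sub_cancel_left, mulVec_mul_mulVec_mul]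
  rw [integral_finsetSum _ fun a _ => integrable_finsetSum _ fun b _ =>
    (integrable_coord_mul_coord_mul_prod_gaussianPDFReal a b).const_mul _]
  simp_rw [integral_finsetSum _ fun b _ =>
    (integrable_coord_mul_coord_mul_prod_gaussianPDFReal _ b).const_mul _]
  simp [integral_const_mul, integral_coord_mul_coord_mul_prod_gaussianPDFReal, Matrix.mul_apply]

theorem densityMean_gaussianDensity (hS : S.PosDef) (μ : Fin k → ℝ) :
    densityMean (gaussianDensity μ S) = μ := by
  ext i
  have h := integral_add (integrable_sub_mul_gaussianDensity hS μ i)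
    ((integrable_gaussianDensity hS μ).const_mul (μ i))
  rw [integral_const_mul, integral_gaussianDensity hS, integral_sub_mul_gaussianDensity hS] at h
  simpa [densityMean, ← add_mul] using h

theorem densityCov_gaussianDensity (hS : S.PosDef) (μ : Fin k → ℝ) :
    densityCov (gaussianDensity μ S) μ = S := by
  ext i j
  exact integral_sub_mul_sub_mul_gaussianDensity hS μ i j

end Moments

end Gaussian

/-! ### Positivity of W⁻¹ - θI and the largest eigenvalue of W. -/

section Spectrum

variable {k : ℕ} {W : Matrix (Fin k) (Fin k) ℝ} {θ : ℝ}

theorem posDef_of_spectrum_pos (hW : W.IsHermitian) (h : ∀ a ∈ spectrum ℝ W, 0 < a) : W.PosDef :=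
  hW.posDef_iff_eigenvalues_pos.mpr fun i => h _ (by
    rw [hW.spectrum_real_eq_range_eigenvalues]; exact Set.mem_range_self i)

theorem spectrum_pos_of_posDef (hW : W.PosDef) {a : ℝ} (ha : a ∈ spectrum ℝ W) : 0 < a := by
  rw [hW.1.spectrum_real_eq_range_eigenvalues] at ha
  obtain ⟨i, rfl⟩ := ha
  exact hW.eigenvalues_pos i

theorem le_sigmaMax {a : ℝ} (ha : a ∈ spectrum ℝ W) : a ≤ sigmaMax W :=
  le_csSup W.finite_spectrum.bddAbove ha

theorem inv_mem_spectrum_of_mem_spectrum_inv (hW : W.PosDef) {a : ℝ} (ha0 : a ≠ 0)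
    (ha : a ∈ spectrum ℝ W⁻¹) : a⁻¹ ∈ spectrum ℝ W := by
  obtain ⟨w, rfl⟩ := hW.isUnit
  rw [← Matrix.coe_units_inv] at ha
  have := (spectrum.inv_mem_iff (r := Units.mk0 a ha0) (a := w⁻¹)).mp ha
  simpa using this

theorem mem_spectrum_inv_of_mem_spectrum (hW : W.PosDef) {a : ℝ}
    (ha : a ∈ spectrum ℝ W) : a⁻¹ ∈ spectrum ℝ W⁻¹ := by
  have ha0 := (spectrum_pos_of_posDef hW ha).ne'
  obtain ⟨w, rfl⟩ := hW.isUnit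
  rw [← Matrix.coe_units_inv]
  have := (spectrum.inv_mem_iff (r := Units.mk0 a ha0) (a := w)).mp ha
  simpa using this

theorem isHermitian_inv_sub_smul_one (hW : W.PosDef) (θ : ℝ) :
    (W⁻¹ - θ • (1 : Matrix (Fin k) (Fin k) ℝ)).IsHermitian :=
  hW.inv.1.sub (by simp [Matrix.IsHermitian])

theorem mem_spectrum_sub_smul_one_iff {M : Matrix (Fin k) (Fin k) ℝ} {a : ℝ} :
    a ∈ spectrum ℝ (M - θ • (1 : Matrix (Fin k) (Fin k) ℝ)) ↔ a + θ ∈ spectrum ℝ M := by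
  rw [← Algebra.algebraMap_eq_smul_one, ← neg_add_eq_sub, spectrum.add_mem_iff]

theorem posDef_inv_sub_of_sigmaMax_lt (hW : W.PosDef) (hθ : 0 < θ) (h : θ * sigmaMax W < 1) :
    (W⁻¹ - θ • (1 : Matrix (Fin k) (Fin k) ℝ)).PosDef := by
  refine posDef_of_spectrum_pos (isHermitian_inv_sub_smul_one hW θ) fun a ha => ?_
  rw [mem_spectrum_sub_smul_one_iff] at ha
  have h1 := spectrum_pos_of_posDef hW.inv ha
  have h2 := le_sigmaMax (inv_mem_spectrum_of_mem_spectrum_inv hW h1.ne' ha)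
  have h3 : θ * (a + θ)⁻¹ < 1 := (mul_le_mul_of_nonneg_left h2 hθ.le).trans_lt h
  rw [mul_inv_lt_iff₀ h1] at h3
  linarith

/-- Supplies some exponential moment, and hence second moments, whatever the risk parameter of the
game. -/
theorem exists_posDef_inv_sub (hW : W.PosDef) :
    ∃ θ : ℝ, 0 < θ ∧ (W⁻¹ - θ • (1 : Matrix (Fin k) (Fin k) ℝ)).PosDef := by
  have h : ∃ θ : ℝ, 0 < θ ∧ θ * sigmaMax W < 1 := by
    refine ⟨(|sigmaMax W| + 1)⁻¹, by positivity, ?_⟩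
    rw [inv_mul_lt_iff₀ (by positivity)]
    linarith [le_abs_self (sigmaMax W)]
  obtain ⟨θ, h0, h1⟩ := h
  exact ⟨θ, h0, posDef_inv_sub_of_sigmaMax_lt hW h0 h1⟩

/-- The threshold is κ = 1/σ_max(W), where W⁻¹ - κI first becomes singular. -/
theorem exists_critical_of_one_le (hW : W.PosDef) (h : 1 ≤ θ * sigmaMax W) :
    ∃ κ, 0 < κ ∧ κ ≤ θ ∧ (W⁻¹ - κ • (1 : Matrix (Fin k) (Fin k) ℝ)).det = 0 ∧
      ∀ η, 0 < η → η < κ → (W⁻¹ - η • (1 : Matrix (Fin k) (Fin k) ℝ)).PosDef := by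
  -- In dimension zero `sigmaMax W` is `sSup ∅ = 0`, which contradicts `h`.
  have hne : (spectrum ℝ W).Nonempty := by
    rw [Set.nonempty_iff_ne_empty]
    intro h0
    norm_num [sigmaMax, h0] at h
  have hmem : sigmaMax W ∈ spectrum ℝ W := hne.csSup_mem W.finite_spectrum
  have hpos := spectrum_pos_of_posDef hW hmem
  refine ⟨(sigmaMax W)⁻¹, inv_pos.mpr hpos, ?_, ?_, fun η h0 h1 => ?_⟩
  · rwa [inv_le_iff_one_le_mul₀ hpos]
  · have := mem_spectrum_inv_of_mem_spectrum hW hmem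
    rw [← zero_add (sigmaMax W)⁻¹, ← mem_spectrum_sub_smul_one_iff, spectrum.zero_mem_iff,
      Matrix.isUnit_iff_isUnit_det, isUnit_iff_ne_zero, not_not] at this
    exact this
  · refine posDef_inv_sub_of_sigmaMax_lt hW h0 ?_
    rwa [lt_inv_comm₀ h0 hpos, ← mul_lt_mul_iff_right₀ h0, mul_inv_cancel₀ h0.ne'] at h1

end Spectrum

/-! ### Exponential tilting of a Gaussian density. -/

section Tilt

variable {k : ℕ} {W : Matrix (Fin k) (Fin k) ℝ} {θ : ℝ}

/-- Both exponents are quadratic in x - μ and add up to the precision matrix W⁻¹ - θI; the square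
root compensates the change of normalization. -/
theorem exp_mul_gaussianDensity (hW : W.PosDef)
    (hV : (W⁻¹ - θ • (1 : Matrix (Fin k) (Fin k) ℝ)).PosDef) (μ x : Fin k → ℝ) :
    Real.exp (θ / 2 * ((x - μ) ⬝ᵥ (x - μ))) * gaussianDensity μ W x =
      Real.sqrt (W⁻¹.det / (W⁻¹ - θ • (1 : Matrix (Fin k) (Fin k) ℝ)).det) *
        gaussianDensity μ (W⁻¹ - θ • (1 : Matrix (Fin k) (Fin k) ℝ))⁻¹ x := by
  have h1 := hW.det_pos
  have h2 := hV.det_pos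
  unfold gaussianDensity
  generalize x - μ = d
  rw [Matrix.nonsing_inv_nonsing_inv _ h2.ne'.isUnit, Matrix.det_nonsing_inv, Matrix.det_nonsing_inv,
    Ring.inverse_eq_inv', Matrix.sub_mulVec, dotProduct_sub, Matrix.smul_mulVec,
    Matrix.one_mulVec, dotProduct_smul, smul_eq_mul]
  set M := W⁻¹ - θ • (1 : Matrix (Fin k) (Fin k) ℝ)
  have e : Real.exp (-(1 / 2) * (d ⬝ᵥ W⁻¹ *ᵥ d - θ * (d ⬝ᵥ d))) =
      Real.exp (θ / 2 * (d ⬝ᵥ d)) *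
        Real.exp (-(1 / 2) * (d ⬝ᵥ W⁻¹ *ᵥ d)) := by
    rw [← Real.exp_add]; ring_nf
  rw [e, Real.sqrt_div (by positivity), Real.sqrt_inv, Real.sqrt_mul (by positivity),
    Real.sqrt_mul (by positivity), Real.sqrt_inv]
  have := Real.sqrt_pos.mpr h1
  have := Real.sqrt_pos.mpr h2
  have : 0 < Real.sqrt ((2 * Real.pi) ^ k) := Real.sqrt_pos.mpr (by positivity)
  field_simp

end Tilt

/-! ### Bayes' rule for a linear Gaussian observation. -/

section Bayes

variable {n m : ℕ} (S : Model n m) {P : Matrix (Fin n) (Fin n) ℝ}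

/-- The predicted covariance `C P Cᵀ + R` of the observation. -/
noncomputable def Model.innovCov (P : Matrix (Fin n) (Fin n) ℝ) : Matrix (Fin m) (Fin m) ℝ :=
  S.C * P * S.Cᵀ + S.R

/-- The information matrix `P⁻¹ + Cᵀ R⁻¹ C`. -/
noncomputable def Model.infoMatrix (P : Matrix (Fin n) (Fin n) ℝ) : Matrix (Fin n) (Fin n) ℝ :=
  P⁻¹ + S.Cᵀ * S.R⁻¹ * S.C

theorem posSemidef_mul_mul_transpose {k l : ℕ} {P : Matrix (Fin k) (Fin k) ℝ} (hP : P.PosSemidef)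
    (A : Matrix (Fin l) (Fin k) ℝ) : (A * P * Aᵀ).PosSemidef := by
  simpa [Matrix.conjTranspose_eq_transpose_of_trivial] using hP.mul_mul_conjTranspose_same A

theorem Model.posDef_innovCov (hP : P.PosDef) : (S.innovCov P).PosDef :=
  S.posDef_R.posSemidef_add (posSemidef_mul_mul_transpose hP.posSemidef S.C)

theorem Model.posDef_infoMatrix (hP : P.PosDef) : (S.infoMatrix P).PosDef := by
  have := posSemidef_mul_mul_transpose S.posDef_R.inv.posSemidef S.Cᵀ
  rw [Matrix.transpose_transpose] at this
  exact hP.inv.add_posSemidef this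

theorem isUnit_det_of_posDef {k : ℕ} {P : Matrix (Fin k) (Fin k) ℝ} (hP : P.PosDef) :
    IsUnit P.det := hP.det_pos.ne'.isUnit

/-- Woodbury's identity; positive definiteness of `filtCov` follows from this form. -/
theorem Model.inv_infoMatrix (hP : P.PosDef) : (S.infoMatrix P)⁻¹ = S.filtCov P := by
  have hi : P⁻¹⁻¹ = P := Matrix.nonsing_inv_nonsing_inv _ (isUnit_det_of_posDef hP)
  have hr : S.R⁻¹⁻¹ = S.R := Matrix.nonsing_inv_nonsing_inv _ (isUnit_det_of_posDef S.posDef_R)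
  have h := Matrix.add_mul_mul_inv_eq_sub P⁻¹ S.Cᵀ S.R⁻¹ S.C hP.inv.isUnit S.posDef_R.inv.isUnit
    (by rw [hi, hr, add_comm]; exact (S.posDef_innovCov hP).isUnit)
  rw [hi, hr, add_comm S.R] at h
  rw [infoMatrix, h, filtCov, gain, Matrix.sub_mul, Matrix.one_mul]

theorem Model.posDef_filtCov (hP : P.PosDef) : (S.filtCov P).PosDef := by
  rw [← S.inv_infoMatrix hP]
  exact (S.posDef_infoMatrix hP).inv

theorem Model.inv_filtCov (hP : P.PosDef) : (S.filtCov P)⁻¹ = S.infoMatrix P := by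
  rw [← S.inv_infoMatrix hP,
    Matrix.nonsing_inv_nonsing_inv _ (isUnit_det_of_posDef (S.posDef_infoMatrix hP))]

/-- The second form L = P_{t|t} Cᵀ R⁻¹ of the gain, which matches the cross terms when the square is
completed. -/
theorem Model.infoMatrix_mul_gain (hP : P.PosDef) : S.infoMatrix P * S.gain P = S.Cᵀ * S.R⁻¹ := by
  have hu := isUnit_det_of_posDef (S.posDef_innovCov hP)
  have h : S.infoMatrix P * (P * S.Cᵀ) = S.Cᵀ * S.R⁻¹ * S.innovCov P := by
    simp only [infoMatrix, innovCov, Matrix.add_mul, Matrix.mul_add, ← Matrix.mul_assoc,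
      Matrix.nonsing_inv_mul _ (isUnit_det_of_posDef hP), Matrix.one_mul]
    rw [Matrix.mul_assoc S.Cᵀ S.R⁻¹ S.R, Matrix.nonsing_inv_mul _ (isUnit_det_of_posDef S.posDef_R),
      Matrix.mul_one, add_comm]
  rw [gain, ← Matrix.mul_assoc, h, ← innovCov, Matrix.mul_assoc, Matrix.mul_nonsing_inv _ hu,
    Matrix.mul_one]

/-- Identifies the term in the observation alone that is left after completing the square. -/
theorem Model.inv_innovCov_add (hP : P.PosDef) :
    (S.innovCov P)⁻¹ + (S.gain P)ᵀ * (S.Cᵀ * S.R⁻¹) = S.R⁻¹ := by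
  have hu := isUnit_det_of_posDef (S.posDef_innovCov hP)
  have ht : (S.innovCov P)ᵀ = S.innovCov P := (S.posDef_innovCov hP).1
  have hPt : Pᵀ = P := hP.1
  have hg : (S.gain P)ᵀ = (S.innovCov P)⁻¹ * (S.C * P) := by
    rw [gain, ← innovCov, Matrix.transpose_mul, Matrix.transpose_nonsing_inv, ht,
      Matrix.transpose_mul, Matrix.transpose_transpose, hPt]
  have hr : S.R * S.R⁻¹ = 1 := Matrix.mul_nonsing_inv _ (isUnit_det_of_posDef S.posDef_R)
  calc (S.innovCov P)⁻¹ + (S.gain P)ᵀ * (S.Cᵀ * S.R⁻¹)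
      = (S.innovCov P)⁻¹ * S.innovCov P * S.R⁻¹ := by
        rw [hg]
        nth_rw 4 [innovCov]
        simp only [Matrix.mul_add, Matrix.add_mul, Matrix.mul_assoc, hr, Matrix.mul_one]
        rw [add_comm]
    _ = S.R⁻¹ := by rw [Matrix.nonsing_inv_mul _ hu, Matrix.one_mul]

/-- Sylvester's identity det(1 + XY) = det(1 + YX), after factoring R out of `innovCov`. It matches
the normalizing constants in Bayes' rule. -/
theorem Model.det_innovCov (hP : P.PosDef) :
    S.R.det * P.det = (S.innovCov P).det * (S.filtCov P).det := by
  have h1 : S.innovCov P = S.R * (1 + S.R⁻¹ * S.C * (P * S.Cᵀ)) := by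
    simp only [innovCov, Matrix.mul_add, ← Matrix.mul_assoc,
      Matrix.mul_nonsing_inv _ (isUnit_det_of_posDef S.posDef_R), Matrix.mul_one, Matrix.one_mul]
    rw [add_comm]
  have h2 : 1 + P * S.Cᵀ * (S.R⁻¹ * S.C) = P * S.infoMatrix P := by
    simp only [infoMatrix, Matrix.mul_add, ← Matrix.mul_assoc,
      Matrix.mul_nonsing_inv _ (isUnit_det_of_posDef hP)]
  have h3 := (S.posDef_infoMatrix hP).det_pos.ne'
  rw [h1, Matrix.det_mul, Matrix.det_one_add_mul_comm, h2, ← S.inv_infoMatrix hP, Matrix.det_mul,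
    Matrix.det_nonsing_inv, Ring.inverse_eq_inv']
  field_simp

theorem dotProduct_mulVec_mulVec {k l j : ℕ} (A : Matrix (Fin k) (Fin l) ℝ)
    (B : Matrix (Fin k) (Fin j) ℝ) (u : Fin l → ℝ) (v : Fin j → ℝ) :
    (A *ᵥ u) ⬝ᵥ (B *ᵥ v) = u ⬝ᵥ ((Aᵀ * B) *ᵥ v) := by
  rw [← Matrix.mulVec_mulVec, Matrix.dotProduct_mulVec u, ← Matrix.mulVec_transpose,
    Matrix.transpose_transpose]

theorem dotProduct_mulVec_comm_of_symm {k : ℕ} {M : Matrix (Fin k) (Fin k) ℝ} (hM : Mᵀ = M)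
    (u v : Fin k → ℝ) : u ⬝ᵥ (M *ᵥ v) = v ⬝ᵥ (M *ᵥ u) := by
  rw [Matrix.dotProduct_mulVec, ← Matrix.mulVec_transpose, hM, dotProduct_comm]

/-- Completion of the square in u, whose minimizer is u = L v. -/
theorem Model.quadratic_form_bayes (hP : P.PosDef) (u : Fin n → ℝ) (v : Fin m → ℝ) :
    (v - S.C *ᵥ u) ⬝ᵥ (S.R⁻¹ *ᵥ (v - S.C *ᵥ u)) + u ⬝ᵥ (P⁻¹ *ᵥ u) =
      v ⬝ᵥ ((S.innovCov P)⁻¹ *ᵥ v) +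
        (u - S.gain P *ᵥ v) ⬝ᵥ ((S.filtCov P)⁻¹ *ᵥ (u - S.gain P *ᵥ v)) := by
  have hR : S.R⁻¹ᵀ = S.R⁻¹ := S.posDef_R.inv.1
  have hI : (S.infoMatrix P)ᵀ = S.infoMatrix P := (S.posDef_infoMatrix hP).1
  rw [S.inv_filtCov hP]
  simp only [Matrix.mulVec_sub, dotProduct_sub, sub_dotProduct]
  have h1 : (S.gain P *ᵥ v) ⬝ᵥ (S.infoMatrix P *ᵥ (S.gain P *ᵥ v)) =
      v ⬝ᵥ (S.R⁻¹ *ᵥ v) - v ⬝ᵥ ((S.innovCov P)⁻¹ *ᵥ v) := by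
    rw [Matrix.mulVec_mulVec, S.infoMatrix_mul_gain hP, dotProduct_mulVec_mulVec,
      eq_sub_of_add_eq' (S.inv_innovCov_add hP), Matrix.sub_mulVec, dotProduct_sub]
  have h2 : u ⬝ᵥ (S.infoMatrix P *ᵥ (S.gain P *ᵥ v)) = u ⬝ᵥ ((S.Cᵀ * S.R⁻¹) *ᵥ v) := by
    rw [Matrix.mulVec_mulVec, S.infoMatrix_mul_gain hP]
  have h3 : (S.gain P *ᵥ v) ⬝ᵥ (S.infoMatrix P *ᵥ u) = u ⬝ᵥ ((S.Cᵀ * S.R⁻¹) *ᵥ v) := by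
    rw [dotProduct_mulVec_comm_of_symm hI, h2]
  have h4 : (S.C *ᵥ u) ⬝ᵥ (S.R⁻¹ *ᵥ v) = u ⬝ᵥ ((S.Cᵀ * S.R⁻¹) *ᵥ v) := dotProduct_mulVec_mulVec ..
  have h5 : v ⬝ᵥ (S.R⁻¹ *ᵥ (S.C *ᵥ u)) = u ⬝ᵥ ((S.Cᵀ * S.R⁻¹) *ᵥ v) := by
    rw [← dotProduct_mulVec_comm_of_symm hR, h4]
  have h6 : (S.C *ᵥ u) ⬝ᵥ (S.R⁻¹ *ᵥ (S.C *ᵥ u)) = u ⬝ᵥ ((S.Cᵀ * S.R⁻¹ * S.C) *ᵥ u) := by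
    rw [Matrix.mulVec_mulVec, dotProduct_mulVec_mulVec, Matrix.mul_assoc]
  rw [h1, h2, h3, h4, h5, h6, infoMatrix, Matrix.add_mulVec, dotProduct_add]
  ring

theorem Model.nominalObs_mul_gaussianDensity (hP : P.PosDef) (μ x : Fin n → ℝ) (y : Fin m → ℝ) :
    S.nominalObs x y * gaussianDensity μ P x =
      gaussianDensity (S.C *ᵥ μ) (S.innovCov P) y *
        gaussianDensity (S.update P μ y) (S.filtCov P) x := by
  have hq := S.quadratic_form_bayes hP (x - μ) (y - S.C *ᵥ μ)
  have e1 : y - S.C *ᵥ μ - S.C *ᵥ (x - μ) = y - S.C *ᵥ x := by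
    rw [Matrix.mulVec_sub]; abel
  have e2 : x - μ - S.gain P *ᵥ (y - S.C *ᵥ μ) = x - S.update P μ y := by
    rw [update]; abel
  rw [e1, e2] at hq
  have hd := S.det_innovCov hP
  have hs : Real.sqrt ((2 * Real.pi) ^ m * S.R.det) * Real.sqrt ((2 * Real.pi) ^ n * P.det) =
      Real.sqrt ((2 * Real.pi) ^ m * (S.innovCov P).det) *
        Real.sqrt ((2 * Real.pi) ^ n * (S.filtCov P).det) := by
    have := S.posDef_R.det_pos
    have := (S.posDef_innovCov hP).det_pos
    rw [← Real.sqrt_mul (by positivity), ← Real.sqrt_mul (by positivity)]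
    congr 1
    linear_combination (2 * Real.pi) ^ m * (2 * Real.pi) ^ n * hd
  unfold nominalObs gaussianDensity
  rw [mul_mul_mul_comm, ← mul_inv, hs, ← Real.exp_add, ← mul_add, hq,
    mul_mul_mul_comm (Real.sqrt ((2 * Real.pi) ^ m * (S.innovCov P).det))⁻¹, ← mul_inv,
    ← Real.exp_add, ← mul_add]

end Bayes

/-! ### The Gibbs variational principle. -/

section Entropy

variable {Ω : Type*} [MeasurableSpace Ω] {ν : Measure Ω} {q F a : Ω → ℝ}

/-- `F` is a probability density of finite relative entropy with respect to `q`. -/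
structure IsFiniteEntropy (ν : Measure Ω) (q F : Ω → ℝ) : Prop where
  nonneg : ∀ w, 0 ≤ F w
  integrable : Integrable F ν
  mass : ∫ w, F w ∂ν = 1
  entropy : Integrable (fun w => F w * Real.log (F w / q w)) ν

/-- Young's inequality for the conjugate functions F log(F/q) - F and q exp a; it is log s ≥ 1 - 1/s
at s = F/(q exp a). -/
theorem mul_le_entropy {F q : ℝ} (hF : 0 ≤ F) (hq : 0 < q) (a : ℝ) :
    a * F ≤ F * Real.log (F / q) - F + q * Real.exp a := by
  rcases hF.eq_or_lt with rfl | hF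
  · simp; positivity
  · have h := Real.one_sub_inv_le_log_of_pos (x := F / (q * Real.exp a)) (by positivity)
    have h1 : Real.log (F / (q * Real.exp a)) = Real.log (F / q) - a := by
      rw [← div_div, Real.log_div (by positivity) (by positivity), Real.log_exp]
    rw [h1, inv_div] at h
    have h2 := mul_le_mul_of_nonneg_left h hF.le
    have h3 : F * (1 - q * Real.exp a / F) = F - q * Real.exp a := by field_simp
    linarith

theorem eq_of_mul_eq_entropy {F q : ℝ} (hF : 0 ≤ F) (hq : 0 < q) {a : ℝ}
    (h : F * Real.log (F / q) - F + q * Real.exp a = a * F) : F = q * Real.exp a := by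
  rcases hF.eq_or_lt with rfl | hF
  · simpa using h.symm
  · by_contra hne
    have h0 := Real.log_lt_sub_one_of_pos (x := q * Real.exp a / F) (by positivity) (by
      rw [Ne, div_eq_one_iff_eq hF.ne']; exact fun h => hne h.symm)
    have h1 : Real.log (q * Real.exp a / F) = a - Real.log (F / q) := by
      rw [Real.log_div (by positivity) hF.ne', Real.log_mul hq.ne' (by positivity), Real.log_exp,
        Real.log_div hF.ne' hq.ne']
      ring
    rw [h1] at h0
    have h2 := mul_lt_mul_of_pos_left h0 hF
    have h3 : F * (q * Real.exp a / F - 1) = q * Real.exp a - F := by field_simp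
    linarith

/-- Young's inequality dominates aF: finite entropy and an exponential moment under q give a moment
under F. -/
theorem IsFiniteEntropy.integrable_mul (hF : IsFiniteEntropy ν q F) (hq : ∀ w, 0 < q w)
    (ha : AEStronglyMeasurable a ν) (ha0 : ∀ w, 0 ≤ a w)
    (hqa : Integrable (fun w => q w * Real.exp (a w)) ν) :
    Integrable (fun w => a w * F w) ν := by
  refine ((hF.entropy.sub hF.integrable).add hqa).mono' (ha.mul hF.integrable.1)
    (.of_forall fun w => ?_)
  rw [Real.norm_of_nonneg (mul_nonneg (ha0 w) (hF.nonneg w))]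
  exact mul_le_entropy (hF.nonneg w) (hq w) (a w)

section Bound

variable (hF : IsFiniteEntropy ν q F) (hq : ∀ w, 0 < q w)
  (hqa : Integrable (fun w => q w * Real.exp (a w)) ν)
  (hZ : 0 < ∫ w, q w * Real.exp (a w) ∂ν)
  (haF : Integrable (fun w => a w * F w) ν)

-- With Z = ∫ q exp a, Young's inequality is used for a - log Z: then q exp(a - log Z) has mass one,
-- like F. The integrated gap is exactly the deficit in the variational inequality, so its sign
-- gives the inequality and its vanishing the equality case.
include hF hqa hZ haF in
theorem IsFiniteEntropy.integral_gap :
    Integrable (fun w => F w * Real.log (F w / q w) - F w +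
      q w * Real.exp (a w - Real.log (∫ w, q w * Real.exp (a w) ∂ν)) -
      (a w - Real.log (∫ w, q w * Real.exp (a w) ∂ν)) * F w) ν ∧
    ∫ w, (F w * Real.log (F w / q w) - F w +
      q w * Real.exp (a w - Real.log (∫ w, q w * Real.exp (a w) ∂ν)) -
      (a w - Real.log (∫ w, q w * Real.exp (a w) ∂ν)) * F w) ∂ν =
    Real.log (∫ w, q w * Real.exp (a w) ∂ν) -
      (∫ w, a w * F w ∂ν - ∫ w, F w * Real.log (F w / q w) ∂ν) := by
  set Z := ∫ w, q w * Real.exp (a w) ∂ν with hZdef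
  have e1 : ∀ w, q w * Real.exp (a w - Real.log Z) = Z⁻¹ * (q w * Real.exp (a w)) := fun w => by
    rw [Real.exp_sub, Real.exp_log hZ]; field_simp
  simp only [e1, sub_mul]
  have i1 := hF.entropy.sub hF.integrable
  have i2 := hqa.const_mul Z⁻¹
  have i3 := haF.sub (hF.integrable.const_mul (Real.log Z))
  refine ⟨(i1.add i2).sub i3, ?_⟩
  have h1 := integral_sub (i1.add i2) i3
  have h2 := integral_add i1 i2
  have h3 := integral_sub hF.entropy hF.integrable
  have h4 := integral_sub haF (hF.integrable.const_mul (Real.log Z))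
  simp only [Pi.add_apply, Pi.sub_apply] at h1 h2
  rw [h1, h2, h3, h4, integral_const_mul, integral_const_mul, hF.mass, ← hZdef,
    inv_mul_cancel₀ hZ.ne']
  ring

include hF hq hqa hZ haF in
/-- The Gibbs variational inequality. -/
theorem IsFiniteEntropy.integral_mul_sub_entropy_le :
    ∫ w, a w * F w ∂ν - ∫ w, F w * Real.log (F w / q w) ∂ν ≤
      Real.log (∫ w, q w * Real.exp (a w) ∂ν) := by
  have h := (hF.integral_gap hqa hZ haF).2
  have h0 := integral_nonneg (μ := ν) fun w => sub_nonneg.mpr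
    (mul_le_entropy (hF.nonneg w) (hq w) (a w - Real.log (∫ w, q w * Real.exp (a w) ∂ν)))
  rw [h] at h0
  linarith

include hF hq hqa hZ haF in
/-- The equality case of the Gibbs variational inequality. -/
theorem IsFiniteEntropy.ae_eq_of_le (hle : Real.log (∫ w, q w * Real.exp (a w) ∂ν) ≤
      ∫ w, a w * F w ∂ν - ∫ w, F w * Real.log (F w / q w) ∂ν) :
    F =ᵐ[ν] fun w => (∫ w, q w * Real.exp (a w) ∂ν)⁻¹ * (q w * Real.exp (a w)) := by
  obtain ⟨hi, h⟩ := hF.integral_gap hqa hZ haF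
  have hnn := fun w => sub_nonneg.mpr
    (mul_le_entropy (hF.nonneg w) (hq w) (a w - Real.log (∫ w, q w * Real.exp (a w) ∂ν)))
  have h0 := hF.integral_mul_sub_entropy_le hq hqa hZ haF
  have h1 : ∫ w, (F w * Real.log (F w / q w) - F w +
      q w * Real.exp (a w - Real.log (∫ w, q w * Real.exp (a w) ∂ν)) -
      (a w - Real.log (∫ w, q w * Real.exp (a w) ∂ν)) * F w) ∂ν = 0 := by
    rw [h]; linarith
  rw [integral_eq_zero_iff_of_nonneg hnn hi] at h1
  filter_upwards [h1] with w hw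
  rw [eq_of_mul_eq_entropy (hF.nonneg w) (hq w) (sub_eq_zero.mp hw), Real.exp_sub, Real.exp_log hZ]
  field_simp

end Bound

/-- The Gibbs density attains the variational bound. -/
theorem isFiniteEntropy_gibbs (hq : ∀ w, 0 < q w)
    (hqa : Integrable (fun w => q w * Real.exp (a w)) ν)
    (hZ : 0 < ∫ w, q w * Real.exp (a w) ∂ν)
    (haqa : Integrable (fun w => a w * (q w * Real.exp (a w))) ν)
    (hF : ∀ w, F w = (∫ w, q w * Real.exp (a w) ∂ν)⁻¹ * (q w * Real.exp (a w))) :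
    IsFiniteEntropy ν q F ∧ Integrable (fun w => a w * F w) ν ∧
      ∫ w, a w * F w ∂ν - ∫ w, F w * Real.log (F w / q w) ∂ν =
        Real.log (∫ w, q w * Real.exp (a w) ∂ν) := by
  set Z := ∫ w, q w * Real.exp (a w) ∂ν with hZdef
  have hFi : Integrable F ν := by
    rw [funext hF]; exact hqa.const_mul _
  have hm : ∫ w, F w ∂ν = 1 := by
    rw [funext hF, integral_const_mul, ← hZdef, inv_mul_cancel₀ hZ.ne']
  have haF : Integrable (fun w => a w * F w) ν := by
    refine (haqa.const_mul Z⁻¹).congr (.of_forall fun w => ?_)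
    simp only [hF]; ring
  have he : ∀ w, F w * Real.log (F w / q w) = a w * F w - Real.log Z * F w := fun w => by
    have h1 : F w / q w = Real.exp (a w) / Z := by
      have := (hq w).ne'
      rw [hF]; field_simp
    rw [h1, Real.log_div (by positivity) hZ.ne', Real.log_exp]; ring
  have hei : Integrable (fun w => F w * Real.log (F w / q w)) ν := by
    simp only [he]; exact haF.sub (hFi.const_mul _)
  refine ⟨⟨fun w => ?_, hFi, hm, hei⟩, haF, ?_⟩
  · have := hq w
    rw [hF]; positivity
  · simp only [he]
    rw [integral_sub haF (hFi.const_mul _), integral_const_mul, hm]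
    ring

/-- If the variational functional is bounded by `c` then the partition function is at most
`exp c`. -/
theorem lintegral_exp_le_of_forall_le (hq : ∀ w, 0 < q w) (hqm : Measurable q)
    (hqi : Integrable q ν) (ha : Measurable a) {c : ℝ}
    (h : ∀ F, Measurable F → IsFiniteEntropy ν q F → Integrable (fun w => a w * F w) ν →
      ∫ w, a w * F w ∂ν - ∫ w, F w * Real.log (F w / q w) ∂ν ≤ c) :
    ∫⁻ w, ENNReal.ofReal (q w * Real.exp (a w)) ∂ν ≤ ENNReal.ofReal (Real.exp c) := by
  -- q exp a may fail to be integrable, so the Gibbs density is truncated to sets where a is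
  -- bounded. There it is admissible, and monotone convergence recovers the full integral.
  let B : ℕ → Set Ω := fun k => {w | |a w| ≤ k}
  have hB : ∀ k, MeasurableSet (B k) := fun k => measurableSet_le ha.abs measurable_const
  have hU : ⋃ k, B k = Set.univ := Set.eq_univ_of_forall fun w =>
    Set.mem_iUnion.mpr (exists_nat_ge |a w|)
  have hmono : Monotone B := fun k l hkl w (hw : |a w| ≤ k) =>
    hw.trans (Nat.cast_le.mpr hkl)
  rw [← setLIntegral_univ, ← hU, setLIntegral_iUnion_of_directed _ hmono.directed_le]
  refine iSup_le fun k => ?_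
  have hmE : Measurable fun w => q w * Real.exp (a w) := by fun_prop
  let E : Ω → ℝ := (B k).indicator fun w => q w * Real.exp (a w)
  have hEm : Measurable E := hmE.indicator (hB k)
  have hE0 : ∀ w, 0 ≤ E w := fun w => Set.indicator_nonneg (fun w _ => by
    have := hq w; positivity) w
  have hEi : Integrable E ν := by
    refine (hqi.mul_const (Real.exp k)).mono' hEm.aestronglyMeasurable (.of_forall fun w => ?_)
    rw [Real.norm_of_nonneg (hE0 w)]
    have := hq w
    by_cases hw : w ∈ B k
    · simp only [E, Set.indicator_of_mem hw]
      have : a w ≤ k := (le_abs_self _).trans hw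
      gcongr
    · simp only [E, Set.indicator_of_notMem hw]; positivity
  have hZeq : ∫⁻ w in B k, ENNReal.ofReal (q w * Real.exp (a w)) ∂ν =
      ENNReal.ofReal (∫ w, E w ∂ν) := by
    rw [ofReal_integral_eq_lintegral_ofReal hEi (.of_forall hE0), ← lintegral_indicator (hB k)]
    refine lintegral_congr fun w => ?_
    by_cases hw : w ∈ B k <;> simp [E, hw]
  rw [hZeq]
  refine ENNReal.ofReal_le_ofReal ?_
  set Z := ∫ w, E w ∂ν with hZdef
  -- If the truncated mass is zero it cannot be normalized, but the bound is then trivial.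
  rcases (integral_nonneg (μ := ν) (f := E) hE0).eq_or_lt with hZ | hZ
  · rw [hZdef, ← hZ]; positivity
  rw [← hZdef] at hZ
  let F : Ω → ℝ := fun w => Z⁻¹ * E w
  have hFi : Integrable F ν := hEi.const_mul _
  have hF0 : ∀ w, 0 ≤ F w := fun w => mul_nonneg (inv_nonneg.mpr hZ.le) (hE0 w)
  have hmass : ∫ w, F w ∂ν = 1 := by
    simp only [F]
    rw [integral_const_mul, ← hZdef, inv_mul_cancel₀ hZ.ne']
  have haF : Integrable (fun w => a w * F w) ν := by
    refine (hFi.mul_const (k : ℝ)).mono' (by fun_prop) (.of_forall fun w => ?_)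
    rw [norm_mul, Real.norm_of_nonneg (hF0 w), Real.norm_eq_abs, mul_comm]
    by_cases hw : w ∈ B k
    · exact mul_le_mul_of_nonneg_left hw (hF0 w)
    · simp [F, E, hw]
  have he : ∀ w, F w * Real.log (F w / q w) = a w * F w - Real.log Z * F w := fun w => by
    by_cases hw : w ∈ B k
    · have h1 : F w / q w = Real.exp (a w) / Z := by
        have := (hq w).ne'
        simp only [F, E, Set.indicator_of_mem hw]; field_simp
      rw [h1, Real.log_div (by positivity) hZ.ne', Real.log_exp]; ring
    · simp [F, E, hw]
  have hei : Integrable (fun w => F w * Real.log (F w / q w)) ν := by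
    simp only [he]; exact haF.sub (hFi.const_mul _)
  have hle := h F (hEm.const_mul _) ⟨hF0, hFi, hmass, hei⟩ haF
  simp only [he] at hle
  rw [integral_sub haF (hFi.const_mul _), integral_const_mul, hmass] at hle
  rw [← Real.log_le_iff_le_exp hZ]
  linarith

end Entropy

/-! ### Measurability, and integrals under the shear (x, y) ↦ (x - μ(y), y). -/

section Tools

variable {k l : ℕ}

theorem measurable_gaussianDensity_comp {X : Type*} [MeasurableSpace X]
    (S : Matrix (Fin k) (Fin k) ℝ) {f g : X → Fin k → ℝ} (hf : Measurable f) (hg : Measurable g) :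
    Measurable fun a => gaussianDensity (f a) S (g a) := by
  have h : Measurable fun v : Fin k → ℝ => v ⬝ᵥ (S⁻¹ *ᵥ v) :=
    (by fun_prop : Continuous fun v : Fin k → ℝ => v ⬝ᵥ (S⁻¹ *ᵥ v)).measurable
  unfold gaussianDensity
  exact ((h.comp (hg.sub hf)).const_mul _).exp.const_mul _

theorem measurable_dotProduct_self {X : Type*} [MeasurableSpace X] {f : X → Fin k → ℝ}
    (hf : Measurable f) : Measurable fun a => f a ⬝ᵥ f a :=
  (by fun_prop : Continuous fun v : Fin k → ℝ => v ⬝ᵥ v).measurable.comp hf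

theorem dotProduct_self_nonneg_real (v : Fin k → ℝ) : 0 ≤ v ⬝ᵥ v :=
  Finset.sum_nonneg fun i _ => mul_self_nonneg (v i)

theorem dotProduct_self_sub_le (u v : Fin k → ℝ) :
    (u - v) ⬝ᵥ (u - v) ≤ 2 * (u ⬝ᵥ u) + 2 * (v ⬝ᵥ v) := by
  have h := dotProduct_self_nonneg_real (u + v)
  simp only [add_dotProduct, dotProduct_add, sub_dotProduct, dotProduct_sub] at h ⊢
  linarith

theorem gaussianDensity_eq_zero_mean (μ x : Fin k → ℝ) (S : Matrix (Fin k) (Fin k) ℝ) :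
    gaussianDensity μ S x = gaussianDensity 0 S (x - μ) := by
  simp [gaussianDensity]

theorem gaussianDensity_zero_neg (u : Fin k → ℝ) (S : Matrix (Fin k) (Fin k) ℝ) :
    gaussianDensity 0 S (-u) = gaussianDensity 0 S u := by
  simp [gaussianDensity, Matrix.mulVec_neg]

/-- For fixed y, translation by μ(y) preserves Lebesgue measure, so Fubini decouples the factors.
The joint Gaussian densities below have this form, with μ(y) the conditional mean. -/
theorem integrable_shear {r : (Fin l → ℝ) → ℝ} (hr : Integrable r) {f : (Fin k → ℝ) → ℝ}
    (hfm : Measurable f) (hf : Integrable f) {μ : (Fin l → ℝ) → Fin k → ℝ} (hμ : Measurable μ) :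
    Integrable fun w : (Fin k → ℝ) × (Fin l → ℝ) => r w.2 * f (w.1 - μ w.2) := by
  have hm : AEStronglyMeasurable
      (fun w : (Fin k → ℝ) × (Fin l → ℝ) => r w.2 * f (w.1 - μ w.2)) := by
    refine AEStronglyMeasurable.mul hr.1.comp_snd ?_
    exact (hfm.comp (by fun_prop)).aestronglyMeasurable
  rw [Measure.volume_eq_prod] at hm ⊢
  rw [integrable_prod_iff' hm]
  refine ⟨.of_forall fun y => (hf.comp_sub_right (μ y)).const_mul (r y), ?_⟩
  simp only [norm_mul, integral_const_mul]
  have : ∀ y, ∫ x, ‖f (x - μ y)‖ = ∫ x, ‖f x‖ := fun y =>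
    integral_sub_right_eq_self (fun x => ‖f x‖) (μ y)
  simp only [this]
  exact hr.norm.mul_const _

theorem integral_shear {r : (Fin l → ℝ) → ℝ} (hr : Integrable r) {f : (Fin k → ℝ) → ℝ}
    (hfm : Measurable f) (hf : Integrable f) {μ : (Fin l → ℝ) → Fin k → ℝ} (hμ : Measurable μ) :
    ∫ w : (Fin k → ℝ) × (Fin l → ℝ), r w.2 * f (w.1 - μ w.2) = (∫ y, r y) * ∫ x, f x := by
  have h := integrable_shear hr hfm hf hμ
  rw [Measure.volume_eq_prod] at h ⊢
  rw [integral_prod_symm _ h]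
  have : ∀ y, ∫ x, f (x - μ y) = ∫ x, f x := fun y => integral_sub_right_eq_self f (μ y)
  simp only [integral_const_mul, this, integral_mul_const]

theorem integrable_dotProduct_self_mul_gaussianDensity {S : Matrix (Fin k) (Fin k) ℝ}
    (hS : S.PosDef) : Integrable fun u => (u ⬝ᵥ u) * gaussianDensity 0 S u := by
  simp only [dotProduct, Finset.sum_mul]
  refine integrable_finsetSum _ fun i _ => ?_
  simpa using integrable_sub_mul_sub_mul_gaussianDensity hS 0 i i

end Tools

/-! ### One step of the game: joint densities, moments and payoff. -/

section Step

variable {n m : ℕ} (S : Model n m) {P : Matrix (Fin n) (Fin n) ℝ} {θ : ℝ}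

/-- The nominal joint density of the state and the observation. -/
noncomputable def Model.nominalJoint (P : Matrix (Fin n) (Fin n) ℝ) (μ : Fin n → ℝ)
    (w : (Fin n → ℝ) × (Fin m → ℝ)) : ℝ :=
  S.nominalObs w.1 w.2 * gaussianDensity μ P w.1

/-- The exponent `(θ / 2) ‖x - g y‖²`. -/
noncomputable def quadLoss (θ : ℝ) (g : (Fin m → ℝ) → Fin n → ℝ)
    (w : (Fin n → ℝ) × (Fin m → ℝ)) : ℝ :=
  θ / 2 * ((w.1 - g w.2) ⬝ᵥ (w.1 - g w.2))

/-- The ratio of the normalizations of `N(μ, W)` and of its exponential tilting. -/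
noncomputable def tiltConst (θ : ℝ) (W : Matrix (Fin n) (Fin n) ℝ) : ℝ :=
  Real.sqrt (W⁻¹.det / (W⁻¹ - θ • (1 : Matrix (Fin n) (Fin n) ℝ)).det)

theorem tiltConst_pos {W : Matrix (Fin n) (Fin n) ℝ} (hW : W.PosDef)
    (hV : (W⁻¹ - θ • (1 : Matrix (Fin n) (Fin n) ℝ)).PosDef) : 0 < tiltConst θ W :=
  Real.sqrt_pos.mpr (div_pos hW.inv.det_pos hV.det_pos)

theorem measurable_quadLoss {g : (Fin m → ℝ) → Fin n → ℝ} (hg : Measurable g) :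
    Measurable (quadLoss θ g) := by
  unfold quadLoss
  exact (measurable_dotProduct_self (by fun_prop)).const_mul _

theorem quadLoss_nonneg (hθ : 0 ≤ θ) (g : (Fin m → ℝ) → Fin n → ℝ)
    (w : (Fin n → ℝ) × (Fin m → ℝ)) : 0 ≤ quadLoss θ g w :=
  mul_nonneg (by positivity) (dotProduct_self_nonneg_real _)

theorem Model.continuous_update (P : Matrix (Fin n) (Fin n) ℝ) :
    Continuous fun p : (Fin n → ℝ) × (Fin m → ℝ) => S.update P p.1 p.2 := by
  unfold update
  fun_prop

theorem Model.measurable_update (P : Matrix (Fin n) (Fin n) ℝ) (μ : Fin n → ℝ) :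
    Measurable (S.update P μ) :=
  (S.continuous_update P).measurable.comp measurable_prodMk_left

theorem Model.measurable_nominalJoint (P : Matrix (Fin n) (Fin n) ℝ) (μ : Fin n → ℝ) :
    Measurable (S.nominalJoint P μ) := by
  unfold nominalJoint nominalObs
  exact (measurable_gaussianDensity_comp _ (by fun_prop) (by fun_prop)).mul
    (measurable_gaussianDensity_comp _ (by fun_prop) (by fun_prop))

theorem Model.nominalObs_pos (x : Fin n → ℝ) (y : Fin m → ℝ) : 0 < S.nominalObs x y :=
  gaussianDensity_pos S.posDef_R _ _

section

variable (hP : P.PosDef) (μ : Fin n → ℝ)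
include hP

theorem Model.nominalJoint_pos (w : (Fin n → ℝ) × (Fin m → ℝ)) : 0 < S.nominalJoint P μ w :=
  mul_pos (S.nominalObs_pos _ _) (gaussianDensity_pos hP _ _)

theorem Model.nominalJoint_eq (w : (Fin n → ℝ) × (Fin m → ℝ)) :
    S.nominalJoint P μ w = gaussianDensity (S.C *ᵥ μ) (S.innovCov P) w.2 *
      gaussianDensity 0 (S.filtCov P) (w.1 - S.update P μ w.2) := by
  rw [nominalJoint, S.nominalObs_mul_gaussianDensity hP, gaussianDensity_eq_zero_mean (S.update P μ w.2)]

theorem Model.integrable_nominalJoint : Integrable (S.nominalJoint P μ) := by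
  rw [funext (S.nominalJoint_eq hP μ)]
  exact integrable_shear (integrable_gaussianDensity (S.posDef_innovCov hP) _)
    (measurable_gaussianDensity_comp _ (by fun_prop) (by fun_prop))
    (integrable_gaussianDensity (S.posDef_filtCov hP) 0) (S.measurable_update P μ)

/-- The loss of `update` depends only on the error x - x̂, so tilting alters the error covariance
and, up to the constant, leaves the law of y untouched. -/
theorem Model.nominalJoint_mul_exp_quadLoss
    (hV : ((S.filtCov P)⁻¹ - θ • (1 : Matrix (Fin n) (Fin n) ℝ)).PosDef)
    (w : (Fin n → ℝ) × (Fin m → ℝ)) :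
    S.nominalJoint P μ w * Real.exp (quadLoss θ (S.update P μ) w) =
      tiltConst θ (S.filtCov P) * (gaussianDensity (S.C *ᵥ μ) (S.innovCov P) w.2 *
        gaussianDensity 0 (S.riskCov θ P) (w.1 - S.update P μ w.2)) := by
  have h := exp_mul_gaussianDensity (S.posDef_filtCov hP) hV 0 (w.1 - S.update P μ w.2)
  rw [sub_zero] at h
  rw [S.nominalJoint_eq hP, quadLoss, mul_assoc, mul_comm (gaussianDensity 0 _ _), h, ← tiltConst,
    riskCov]
  ring

theorem Model.integrable_tilted
    (hV : ((S.filtCov P)⁻¹ - θ • (1 : Matrix (Fin n) (Fin n) ℝ)).PosDef) :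
    Integrable fun w => S.nominalJoint P μ w * Real.exp (quadLoss θ (S.update P μ) w) := by
  simp only [S.nominalJoint_mul_exp_quadLoss hP μ hV]
  exact (integrable_shear (integrable_gaussianDensity (S.posDef_innovCov hP) _)
    (measurable_gaussianDensity_comp _ (by fun_prop) (by fun_prop))
    (integrable_gaussianDensity hV.inv 0) (S.measurable_update P μ)).const_mul _

theorem Model.integral_tilted
    (hV : ((S.filtCov P)⁻¹ - θ • (1 : Matrix (Fin n) (Fin n) ℝ)).PosDef) :
    ∫ w, S.nominalJoint P μ w * Real.exp (quadLoss θ (S.update P μ) w) =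
      tiltConst θ (S.filtCov P) := by
  simp only [S.nominalJoint_mul_exp_quadLoss hP μ hV]
  have hV' : (S.riskCov θ P).PosDef := hV.inv
  rw [integral_const_mul, integral_shear (integrable_gaussianDensity (S.posDef_innovCov hP) _)
    (measurable_gaussianDensity_comp _ (by fun_prop) (by fun_prop))
    (integrable_gaussianDensity hV' 0) (S.measurable_update P μ),
    integral_gaussianDensity (S.posDef_innovCov hP), integral_gaussianDensity hV']
  simp

theorem Model.integrable_quadLoss_mul_tilted
    (hV : ((S.filtCov P)⁻¹ - θ • (1 : Matrix (Fin n) (Fin n) ℝ)).PosDef) :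
    Integrable fun w => quadLoss θ (S.update P μ) w *
      (S.nominalJoint P μ w * Real.exp (quadLoss θ (S.update P μ) w)) := by
  simp only [S.nominalJoint_mul_exp_quadLoss hP μ hV]
  have h := integrable_shear (integrable_gaussianDensity (S.posDef_innovCov hP) (S.C *ᵥ μ))
    ((measurable_dotProduct_self measurable_id).mul
      (measurable_gaussianDensity_comp (S.riskCov θ P) (f := fun _ => 0) (by fun_prop)
        measurable_id))
    (integrable_dotProduct_self_mul_gaussianDensity hV.inv) (S.measurable_update P μ)
  refine (h.const_mul (θ / 2 * tiltConst θ (S.filtCov P))).congr (.of_forall fun w => ?_)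
  simp only [quadLoss, id, Pi.mul_apply]
  ring

/-- All the densities of finite entropy have second moments. -/
theorem Model.integrable_sq_sub_update_mul {F : (Fin n → ℝ) × (Fin m → ℝ) → ℝ}
    (hF : IsFiniteEntropy volume (S.nominalJoint P μ) F) :
    Integrable fun w => ((w.1 - S.update P μ w.2) ⬝ᵥ (w.1 - S.update P μ w.2)) * F w := by
  -- The level η is unrelated to θ: any small exponential moment suffices.
  obtain ⟨η, h0, hV⟩ := exists_posDef_inv_sub (S.posDef_filtCov hP)
  have h := hF.integrable_mul (S.nominalJoint_pos hP μ)
    (measurable_quadLoss (S.measurable_update P μ)).aestronglyMeasurable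
    (quadLoss_nonneg h0.le _) (S.integrable_tilted hP μ hV)
  refine (h.const_mul (2 / η)).congr (.of_forall fun w => ?_)
  simp only [quadLoss]
  field_simp

theorem Model.integrable_sq_state_mul {F : (Fin n → ℝ) × (Fin m → ℝ) → ℝ}
    (hF : IsFiniteEntropy volume (S.nominalJoint P μ) F) :
    Integrable fun w => (w.1 ⬝ᵥ w.1) * F w := by
  obtain ⟨η, h0, hV⟩ := exists_posDef_inv_sub hP
  -- The weight depends on x alone: it tilts the prior and keeps the noise y - Cx, so the shear is
  -- taken over x instead of y.
  have hi : Integrable fun w : (Fin n → ℝ) × (Fin m → ℝ) =>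
      S.nominalJoint P μ w * Real.exp (η / 2 * ((w.1 - μ) ⬝ᵥ (w.1 - μ))) := by
    have h := (integrable_shear (integrable_gaussianDensity hV.inv μ)
      (measurable_gaussianDensity_comp S.R (f := fun _ => 0) (by fun_prop) measurable_id)
      (integrable_gaussianDensity S.posDef_R 0)
      (μ := fun x => S.C *ᵥ x) (by fun_prop)).swap
    refine (h.const_mul (tiltConst η P)).congr (.of_forall fun w => ?_)
    have e := exp_mul_gaussianDensity hP hV μ w.1
    rw [← tiltConst] at e
    simp only [Function.comp_apply, Prod.fst_swap, Prod.snd_swap, id, nominalJoint, nominalObs]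
    rw [gaussianDensity_eq_zero_mean (S.C *ᵥ w.1), ← mul_assoc, ← e]
    ring
  have h := hF.integrable_mul (S.nominalJoint_pos hP μ)
    ((measurable_dotProduct_self (by fun_prop)).const_mul _).aestronglyMeasurable
    (fun w => mul_nonneg (by positivity) (dotProduct_self_nonneg_real _)) hi
  -- From ‖x‖² ≤ 2‖x - μ‖² + 2‖μ‖², the first term being 4/η times (η/2)‖x - μ‖².
  have h2 := (h.const_mul (4 / η)).add (hF.integrable.const_mul (2 * (μ ⬝ᵥ μ)))
  refine h2.mono' ((measurable_dotProduct_self (by fun_prop)).aestronglyMeasurable.mul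
    hF.integrable.1) (.of_forall fun w => ?_)
  rw [Real.norm_of_nonneg (mul_nonneg (dotProduct_self_nonneg_real _) (hF.nonneg w))]
  have h3 := dotProduct_self_sub_le (w.1 - μ) (-μ)
  rw [sub_neg_eq_add, sub_add_cancel, neg_dotProduct_neg] at h3
  refine (mul_le_mul_of_nonneg_right h3 (hF.nonneg w)).trans (le_of_eq ?_)
  simp only [Pi.add_apply]
  field_simp
  ring

theorem Model.integrable_sq_update_mul {F : (Fin n → ℝ) × (Fin m → ℝ) → ℝ}
    (hF : IsFiniteEntropy volume (S.nominalJoint P μ) F) :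
    Integrable fun w => (S.update P μ w.2 ⬝ᵥ S.update P μ w.2) * F w := by
  have h2 := ((S.integrable_sq_state_mul hP μ hF).const_mul 2).add
    ((S.integrable_sq_sub_update_mul hP μ hF).const_mul 2)
  have hm := S.measurable_update P μ
  refine h2.mono' ((measurable_dotProduct_self (by fun_prop)).aestronglyMeasurable.mul
    hF.integrable.1) (.of_forall fun w => ?_)
  rw [Real.norm_of_nonneg (mul_nonneg (dotProduct_self_nonneg_real _) (hF.nonneg w))]
  have h3 := dotProduct_self_sub_le w.1 (w.1 - S.update P μ w.2)
  rw [sub_sub_cancel] at h3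
  refine (mul_le_mul_of_nonneg_right h3 (hF.nonneg w)).trans (le_of_eq ?_)
  simp only [Pi.add_apply]
  ring

theorem Model.integrable_quadLoss_mul {F : (Fin n → ℝ) × (Fin m → ℝ) → ℝ} (hθ : 0 ≤ θ)
    (hF : IsFiniteEntropy volume (S.nominalJoint P μ) F) {g : (Fin m → ℝ) → Fin n → ℝ}
    (hg : Measurable g) (hgF : Integrable fun w => (g w.2 ⬝ᵥ g w.2) * F w) :
    Integrable fun w => quadLoss θ g w * F w := by
  have h2 := (((S.integrable_sq_state_mul hP μ hF).const_mul 2).add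
    (hgF.const_mul 2)).const_mul (θ / 2)
  refine h2.mono' ((measurable_quadLoss hg).aestronglyMeasurable.mul
    hF.integrable.1) (.of_forall fun w => ?_)
  rw [Real.norm_of_nonneg (mul_nonneg (quadLoss_nonneg hθ _ _) (hF.nonneg w))]
  have h3 := mul_le_mul_of_nonneg_left (dotProduct_self_sub_le w.1 (g w.2)) (by positivity : 0 ≤ θ / 2)
  refine (mul_le_mul_of_nonneg_right h3 (hF.nonneg w)).trans (le_of_eq ?_)
  simp only [Pi.add_apply]
  ring

/-! ### Admissible observation densities as joint densities of finite entropy -/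

theorem Model.mul_log_div_nominalJoint (φ : (Fin n → ℝ) → (Fin m → ℝ) → ℝ)
    (w : (Fin n → ℝ) × (Fin m → ℝ)) :
    φ w.1 w.2 * gaussianDensity μ P w.1 *
        Real.log (φ w.1 w.2 * gaussianDensity μ P w.1 / S.nominalJoint P μ w) =
      φ w.1 w.2 * gaussianDensity μ P w.1 * Real.log (φ w.1 w.2 / S.nominalObs w.1 w.2) := by
  rw [nominalJoint, mul_div_mul_right _ _ (gaussianDensity_pos hP μ w.1).ne']

theorem Model.IsObsDensity.isFiniteEntropy {S : Model n m} {φ : (Fin n → ℝ) → (Fin m → ℝ) → ℝ}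
    (hφ : S.IsObsDensity (gaussianDensity μ P) φ) :
    IsFiniteEntropy volume (S.nominalJoint P μ)
      fun w => φ w.1 w.2 * gaussianDensity μ P w.1 where
  nonneg w := mul_nonneg (hφ.nonneg _ _) (gaussianDensity_pos hP _ _).le
  integrable := hφ.integrable
  mass := hφ.mass
  entropy := by simpa only [S.mul_log_div_nominalJoint hP μ] using hφ.finite_div

/-- Since only the joint mass is normalized, dividing by the positive prior makes any such F a
candidate; no condition on ∫ φ(y | x) dy arises. -/
theorem Model.isObsDensity_of_isFiniteEntropy {F : (Fin n → ℝ) × (Fin m → ℝ) → ℝ}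
    (hFm : Measurable F) (hF : IsFiniteEntropy volume (S.nominalJoint P μ) F)
    {φ : (Fin n → ℝ) → (Fin m → ℝ) → ℝ}
    (hφ : ∀ w : (Fin n → ℝ) × (Fin m → ℝ), φ w.1 w.2 * gaussianDensity μ P w.1 = F w) :
    S.IsObsDensity (gaussianDensity μ P) φ := by
  have e : ∀ w : (Fin n → ℝ) × (Fin m → ℝ), φ w.1 w.2 = F w / gaussianDensity μ P w.1 := fun w => by
    rw [← hφ, mul_div_cancel_right₀ _ (gaussianDensity_pos hP μ w.1).ne']
  refine ⟨?_, fun x y => ?_, ?_, ?_, ?_⟩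
  · rw [funext e]
    exact hFm.div (measurable_gaussianDensity_comp _ (by fun_prop) (by fun_prop))
  · rw [e (x, y)]
    exact div_nonneg (hF.nonneg _) (gaussianDensity_pos hP _ _).le
  · simpa only [hφ] using hF.integrable
  · simpa only [hφ] using hF.mass
  · have := hF.entropy
    simp only [← hφ, S.mul_log_div_nominalJoint hP μ] at this
    exact this

theorem Model.mul_payoff (hθ : 0 < θ) (φ : (Fin n → ℝ) → (Fin m → ℝ) → ℝ)
    (g : (Fin m → ℝ) → Fin n → ℝ) :
    θ * S.payoff θ (gaussianDensity μ P) φ g =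
      (∫ w, quadLoss θ g w * (φ w.1 w.2 * gaussianDensity μ P w.1)) -
      ∫ w : (Fin n → ℝ) × (Fin m → ℝ), φ w.1 w.2 * gaussianDensity μ P w.1 *
        Real.log (φ w.1 w.2 * gaussianDensity μ P w.1 / S.nominalJoint P μ w) := by
  simp only [S.mul_log_div_nominalJoint hP μ, quadLoss, mul_assoc (θ / 2), integral_const_mul]
  rw [payoff, meanSquareError, divergence, mul_sub, ← mul_assoc θ θ⁻¹, mul_inv_cancel₀ hθ.ne']
  ring

end

end Step

/-! ### Lower bounds for the exponential cost of an estimator. -/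

section LowerBound

variable {n m : ℕ} (S : Model n m) {P : Matrix (Fin n) (Fin n) ℝ} {θ η : ℝ}

/-- Moving the center of the quadratic exponent away from the mean only increases the exponential
moment of a centered Gaussian density. -/
theorem le_lintegral_exp_mul_gaussianDensity {W : Matrix (Fin n) (Fin n) ℝ} (hW : W.PosDef)
    (hV : (W⁻¹ - η • (1 : Matrix (Fin n) (Fin n) ℝ)).PosDef) (d : Fin n → ℝ) :
    ENNReal.ofReal (tiltConst η W * Real.exp (η / 2 * (d ⬝ᵥ d))) ≤
      ∫⁻ u, ENNReal.ofReal
        (Real.exp (η / 2 * ((u - d) ⬝ᵥ (u - d))) * gaussianDensity 0 W u) := by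
  set K : (Fin n → ℝ) → ℝ := fun u =>
    Real.exp (η / 2 * (u ⬝ᵥ u)) * gaussianDensity 0 W u with hK
  have hK0 : ∀ u, 0 ≤ K u := fun u => mul_nonneg (Real.exp_pos _).le (gaussianDensity_pos hW _ _).le
  have hKe : ∀ u, K u = tiltConst η W * gaussianDensity 0 (W⁻¹ - η • 1)⁻¹ u := fun u => by
    have := exp_mul_gaussianDensity hW hV 0 u
    rw [sub_zero] at this
    exact this
  have hKm : Measurable K := by
    rw [funext hKe]
    exact (measurable_gaussianDensity_comp _ (by fun_prop) (by fun_prop)).const_mul _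
  have hKint : ∫⁻ u, ENNReal.ofReal (K u) = ENNReal.ofReal (tiltConst η W) := by
    rw [funext hKe, ← ofReal_integral_eq_lintegral_ofReal
      ((integrable_gaussianDensity hV.inv 0).const_mul _)
      (.of_forall fun u => mul_nonneg (tiltConst_pos hW hV).le (gaussianDensity_pos hV.inv _ _).le),
      integral_const_mul, integral_gaussianDensity hV.inv, mul_one]
  set G : (Fin n → ℝ) → ℝ := fun u =>
    Real.exp (η / 2 * ((u - d) ⬝ᵥ (u - d))) * gaussianDensity 0 W u with hG
  have hGe : ∀ u, G u = Real.exp (η / 2 * (d ⬝ᵥ d)) * (K u * Real.exp (-(η * (u ⬝ᵥ d)))) :=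
    fun u => by
      have : η / 2 * ((u - d) ⬝ᵥ (u - d)) =
          η / 2 * (d ⬝ᵥ d) + η / 2 * (u ⬝ᵥ u) + -(η * (u ⬝ᵥ d)) := by
        simp only [sub_dotProduct, dotProduct_sub, dotProduct_comm d u]; ring
      simp only [hG, hK]
      rw [this, Real.exp_add, Real.exp_add]; ring
  have hGm : Measurable G :=
    (((measurable_dotProduct_self (by fun_prop)).const_mul _).exp).mul
      (measurable_gaussianDensity_comp _ (by fun_prop) (by fun_prop))
  have hG0 : ∀ u, 0 ≤ G u := fun u => mul_nonneg (Real.exp_pos _).le (gaussianDensity_pos hW _ _).le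
  have hKneg : ∀ u, K (-u) = K u := fun u => by
    simp [hK, gaussianDensity_zero_neg]
  -- Pairing u with -u removes the linear term of the exponent, by eˢ + e⁻ˢ ≥ 2; K is even.
  have hsum : ∀ u, 2 * (Real.exp (η / 2 * (d ⬝ᵥ d)) * K u) ≤ G u + G (-u) := fun u => by
    rw [hGe, hGe, hKneg, neg_dotProduct]
    have h1 := Real.add_one_le_exp (-(η * (u ⬝ᵥ d)))
    have h2 := Real.add_one_le_exp (-(η * -(u ⬝ᵥ d)))
    have h3 : 2 ≤ Real.exp (-(η * (u ⬝ᵥ d))) + Real.exp (-(η * -(u ⬝ᵥ d))) := by linarith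
    have h4 := mul_le_mul_of_nonneg_left h3 (mul_nonneg (Real.exp_pos (η / 2 * (d ⬝ᵥ d))).le (hK0 u))
    linarith
  have hneg : ∫⁻ u, ENNReal.ofReal (G (-u)) = ∫⁻ u, ENNReal.ofReal (G u) :=
    lintegral_neg_eq_self (μ := volume) fun u => ENNReal.ofReal (G u)
  have h := lintegral_mono (μ := volume) fun u => ENNReal.ofReal_le_ofReal (hsum u)
  simp only [ENNReal.ofReal_add (hG0 _) (hG0 _)] at h
  rw [lintegral_add_left (by fun_prop), hneg, ← two_mul] at h
  simp only [ENNReal.ofReal_mul (zero_le_two (α := ℝ)), ENNReal.ofReal_mul (Real.exp_pos _).le,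
    ENNReal.ofReal_ofNat] at h
  rw [lintegral_const_mul _ (by fun_prop), lintegral_const_mul _ (by fun_prop), hKint] at h
  rw [mul_comm (tiltConst η W), ENNReal.ofReal_mul (Real.exp_pos _).le]
  exact (ENNReal.mul_le_mul_iff_right two_ne_zero ENNReal.ofNat_ne_top).mp h

/-- Obtained by integrating over x first, with d = g y - x̂. The choice η < θ serves when W⁻¹ - θI
is not positive definite; η = θ, with the factor in g kept, gives uniqueness. -/
theorem Model.le_lintegral_exp_quadLoss (hP : P.PosDef) (μ : Fin n → ℝ) (hηθ : η ≤ θ)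
    (hV : ((S.filtCov P)⁻¹ - η • (1 : Matrix (Fin n) (Fin n) ℝ)).PosDef)
    {g : (Fin m → ℝ) → Fin n → ℝ} (hg : Measurable g) :
    ENNReal.ofReal (tiltConst η (S.filtCov P)) *
      ∫⁻ y, ENNReal.ofReal (gaussianDensity (S.C *ᵥ μ) (S.innovCov P) y *
        Real.exp (η / 2 * ((g y - S.update P μ y) ⬝ᵥ (g y - S.update P μ y)))) ≤
      ∫⁻ w, ENNReal.ofReal (S.nominalJoint P μ w * Real.exp (quadLoss θ g w)) := by
  have hq : Measurable fun w => ENNReal.ofReal (S.nominalJoint P μ w * Real.exp (quadLoss θ g w)) := by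
    have := S.measurable_nominalJoint P μ
    have := measurable_quadLoss (θ := θ) hg
    fun_prop
  have hum := S.measurable_update P μ
  rw [Measure.volume_eq_prod, lintegral_prod_symm _ hq.aemeasurable, ← lintegral_const_mul']
  swap
  · exact ENNReal.ofReal_ne_top
  refine lintegral_mono fun y => ?_
  have hp := gaussianDensity_pos (S.posDef_innovCov hP) (S.C *ᵥ μ) y
  have h := le_lintegral_exp_mul_gaussianDensity (S.posDef_filtCov hP) hV (g y - S.update P μ y)
  rw [← lintegral_sub_right_eq_self _ (S.update P μ y)] at h
  have h2 := mul_le_mul_right h (ENNReal.ofReal (gaussianDensity (S.C *ᵥ μ) (S.innovCov P) y))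
  rw [← ENNReal.ofReal_mul hp.le, ← lintegral_const_mul' _ _ ENNReal.ofReal_ne_top] at h2
  refine le_trans (le_of_eq ?_) (h2.trans (lintegral_mono fun x => ?_))
  · rw [← ENNReal.ofReal_mul (tiltConst_pos (S.posDef_filtCov hP) hV).le]
    congr 1; ring
  · rw [← ENNReal.ofReal_mul hp.le]
    refine ENNReal.ofReal_le_ofReal ?_
    rw [S.nominalJoint_eq hP, sub_sub_sub_cancel_right, mul_left_comm, mul_comm, quadLoss]
    have := gaussianDensity_pos (S.posDef_filtCov hP) 0 (x - S.update P μ y)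
    have := dotProduct_self_nonneg_real (x - g y)
    gcongr

theorem Model.tiltConst_le_lintegral_exp_quadLoss (hP : P.PosDef) (μ : Fin n → ℝ) (h0 : 0 ≤ η)
    (hηθ : η ≤ θ) (hV : ((S.filtCov P)⁻¹ - η • (1 : Matrix (Fin n) (Fin n) ℝ)).PosDef)
    {g : (Fin m → ℝ) → Fin n → ℝ} (hg : Measurable g) :
    ENNReal.ofReal (tiltConst η (S.filtCov P)) ≤
      ∫⁻ w, ENNReal.ofReal (S.nominalJoint P μ w * Real.exp (quadLoss θ g w)) := by
  refine le_trans ?_ (S.le_lintegral_exp_quadLoss hP μ hηθ hV hg)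
  refine le_mul_of_one_le_right zero_le ?_
  have hp := gaussianDensity_pos (S.posDef_innovCov hP) (S.C *ᵥ μ)
  have h1 : ∫⁻ y, ENNReal.ofReal (gaussianDensity (S.C *ᵥ μ) (S.innovCov P) y) = 1 := by
    rw [← ofReal_integral_eq_lintegral_ofReal (integrable_gaussianDensity (S.posDef_innovCov hP) _)
      (.of_forall fun y => (hp y).le), integral_gaussianDensity (S.posDef_innovCov hP),
      ENNReal.ofReal_one]
  rw [← h1]
  refine lintegral_mono fun y => ENNReal.ofReal_le_ofReal ?_
  refine le_mul_of_one_le_right (hp y).le (Real.one_le_exp ?_)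
  exact mul_nonneg (by positivity) (dotProduct_self_nonneg_real _)

/-- Beyond the critical value of the risk parameter every estimator has an infinite exponential
cost. -/
theorem Model.sigmaMax_lt_of_lintegral_le (hP : P.PosDef) (μ : Fin n → ℝ)
    {g : (Fin m → ℝ) → Fin n → ℝ} (hg : Measurable g) {c : ℝ}
    (hc : ∫⁻ w, ENNReal.ofReal (S.nominalJoint P μ w * Real.exp (quadLoss θ g w)) ≤
      ENNReal.ofReal c) : θ * sigmaMax (S.filtCov P) < 1 := by
  by_contra! hcon
  set W := S.filtCov P with hWdef
  have hW : W.PosDef := S.posDef_filtCov hP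
  obtain ⟨κ, hκ0, hκθ, hdet, hpd⟩ := exists_critical_of_one_le hW hcon
  -- Squaring `tiltConst η W ≤ c` and clearing the denominator gives an inequality that passes to
  -- the limit η → κ, where its right side vanishes although det W⁻¹ > 0.
  have hbound : ∀ η ∈ Set.Ioo 0 κ,
      W⁻¹.det ≤ c ^ 2 * (W⁻¹ - η • (1 : Matrix (Fin n) (Fin n) ℝ)).det := fun η hη => by
    have hV := hpd η hη.1 hη.2
    have h1 := (S.tiltConst_le_lintegral_exp_quadLoss hP μ hη.1.le (hη.2.le.trans hκθ) hV hg).trans hc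
    have h2 := tiltConst_pos hW hV
    have h3 : tiltConst η W ≤ c := by
      rcases ENNReal.ofReal_le_ofReal_iff'.mp h1 with h | h
      · exact h
      · exact absurd h h2.not_ge
    have h4 := pow_le_pow_left₀ h2.le h3 2
    rw [tiltConst, Real.sq_sqrt (div_pos hW.inv.det_pos hV.det_pos).le,
      div_le_iff₀ hV.det_pos] at h4
    exact h4
  have hcont : Continuous fun η : ℝ => c ^ 2 * (W⁻¹ - η • (1 : Matrix (Fin n) (Fin n) ℝ)).det := by
    fun_prop
  have hlim := (hcont.tendsto κ).mono_left (nhdsWithin_le_nhds (s := Set.Iio κ))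
  rw [hdet, mul_zero] at hlim
  have := ge_of_tendsto hlim (Filter.eventually_of_mem (Ioo_mem_nhdsLT hκ0) hbound)
  exact absurd hW.inv.det_pos this.not_gt

end LowerBound

/-! ### Existence, uniqueness and necessity for the one-step game. -/

section Solution

variable {n m : ℕ} {S : Model n m} {P : Matrix (Fin n) (Fin n) ℝ} {θ : ℝ}

theorem Model.lintegral_exp_le_of_payoff_le (hP : P.PosDef) (μ : Fin n → ℝ) (hθ : 0 < θ)
    {g : (Fin m → ℝ) → Fin n → ℝ} (hg : Measurable g) {r : ℝ}
    (h : ∀ φ, S.IsObsDensity (gaussianDensity μ P) φ → S.payoff θ (gaussianDensity μ P) φ g ≤ r) :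
    ∫⁻ w, ENNReal.ofReal (S.nominalJoint P μ w * Real.exp (quadLoss θ g w)) ≤
      ENNReal.ofReal (Real.exp (θ * r)) := by
  refine lintegral_exp_le_of_forall_le (S.nominalJoint_pos hP μ) (S.measurable_nominalJoint P μ)
    (S.integrable_nominalJoint hP μ) (measurable_quadLoss hg) fun F hFm hF _ => ?_
  have hFφ : ∀ w : (Fin n → ℝ) × (Fin m → ℝ), (fun x y => F (x, y) / gaussianDensity μ P x)
      w.1 w.2 * gaussianDensity μ P w.1 = F w := fun w =>
    div_mul_cancel₀ _ (gaussianDensity_pos hP μ w.1).ne'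
  have h1 := mul_le_mul_of_nonneg_left
    (h (fun x y => F (x, y) / gaussianDensity μ P x)
      (S.isObsDensity_of_isFiniteEntropy hP μ hFm hF hFφ)) hθ.le
  rw [S.mul_payoff hP μ hθ] at h1
  simpa only [hFφ] using h1

/-- An attained maximum is a real number, so the exponential cost of g is finite. -/
theorem Model.IsMinimaxSolution.sigmaMax_lt (hP : P.PosDef) {μ : Fin n → ℝ} (hθ : 0 < θ)
    {φ : (Fin n → ℝ) → (Fin m → ℝ) → ℝ} {g : (Fin m → ℝ) → Fin n → ℝ}
    (h : S.IsMinimaxSolution θ (gaussianDensity μ P) φ g) :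
    θ * sigmaMax (S.filtCov P) < 1 :=
  S.sigmaMax_lt_of_lintegral_le hP μ h.estimator.measurable
    (Model.lintegral_exp_le_of_payoff_le hP μ hθ h.estimator.measurable h.maximal)

/-- The least favorable observation density against the estimator `x̂ + L (y - C x̂)`. -/
noncomputable def Model.worstObs (S : Model n m) (θ : ℝ) (P : Matrix (Fin n) (Fin n) ℝ)
    (μ : Fin n → ℝ) (x : Fin n → ℝ) (y : Fin m → ℝ) : ℝ :=
  (tiltConst θ (S.filtCov P))⁻¹ *
    (S.nominalObs x y * Real.exp (quadLoss θ (S.update P μ) (x, y)))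

theorem Model.isEstimator_update (hP : P.PosDef) (μ : Fin n → ℝ) :
    S.IsEstimator (gaussianDensity μ P) (S.update P μ) :=
  ⟨S.measurable_update P μ, fun _ hφ =>
    S.integrable_sq_update_mul hP μ (hφ.isFiniteEntropy hP μ)⟩

theorem Model.payoff_congr {ρ : (Fin n → ℝ) → ℝ} {g' : (Fin m → ℝ) → Fin n → ℝ}
    (φ : (Fin n → ℝ) → (Fin m → ℝ) → ℝ) (hg : g =ᵐ[volume] g') :
    S.payoff θ ρ φ g = S.payoff θ ρ φ g' := by
  have h : ∀ᵐ w : (Fin n → ℝ) × (Fin m → ℝ), g w.2 = g' w.2 := by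
    rw [Measure.volume_eq_prod]
    exact Measure.quasiMeasurePreserving_snd.ae hg
  rw [payoff, payoff, meanSquareError, meanSquareError]
  congr 2
  refine integral_congr_ae ?_
  filter_upwards [h] with w hw
  rw [hw]

section Subcritical

variable (hP : P.PosDef) (μ : Fin n → ℝ)
  (hV : ((S.filtCov P)⁻¹ - θ • (1 : Matrix (Fin n) (Fin n) ℝ)).PosDef)

theorem Model.worstObs_mul (w : (Fin n → ℝ) × (Fin m → ℝ)) :
    S.worstObs θ P μ w.1 w.2 * gaussianDensity μ P w.1 = (tiltConst θ (S.filtCov P))⁻¹ *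
      (S.nominalJoint P μ w * Real.exp (quadLoss θ (S.update P μ) w)) := by
  rw [worstObs, nominalJoint]; ring

include hP hV

theorem Model.worstObs_mul_eq (w : (Fin n → ℝ) × (Fin m → ℝ)) :
    S.worstObs θ P μ w.1 w.2 * gaussianDensity μ P w.1 =
      gaussianDensity (S.C *ᵥ μ) (S.innovCov P) w.2 *
        gaussianDensity 0 (S.riskCov θ P) (w.1 - S.update P μ w.2) := by
  rw [worstObs_mul, S.nominalJoint_mul_exp_quadLoss hP μ hV,
    inv_mul_cancel_left₀ (tiltConst_pos (S.posDef_filtCov hP) hV).ne']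

theorem Model.worstObs_isFiniteEntropy :
    IsFiniteEntropy volume (S.nominalJoint P μ)
      (fun w => S.worstObs θ P μ w.1 w.2 * gaussianDensity μ P w.1) ∧
    (∫ w, quadLoss θ (S.update P μ) w * (S.worstObs θ P μ w.1 w.2 * gaussianDensity μ P w.1)) -
      ∫ w : (Fin n → ℝ) × (Fin m → ℝ), S.worstObs θ P μ w.1 w.2 * gaussianDensity μ P w.1 *
        Real.log (S.worstObs θ P μ w.1 w.2 * gaussianDensity μ P w.1 / S.nominalJoint P μ w) =
      Real.log (tiltConst θ (S.filtCov P)) := by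
  have hc := tiltConst_pos (S.posDef_filtCov hP) hV
  have h := isFiniteEntropy_gibbs (S.nominalJoint_pos hP μ) (S.integrable_tilted hP μ hV)
    (by rwa [S.integral_tilted hP μ hV]) (S.integrable_quadLoss_mul_tilted hP μ hV)
    (F := fun w => S.worstObs θ P μ w.1 w.2 * gaussianDensity μ P w.1) (fun w => by
      rw [S.integral_tilted hP μ hV, worstObs_mul])
  rw [S.integral_tilted hP μ hV] at h
  exact ⟨h.1, h.2.2⟩

theorem Model.isObsDensity_worstObs :
    S.IsObsDensity (gaussianDensity μ P) (S.worstObs θ P μ) := by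
  refine S.isObsDensity_of_isFiniteEntropy hP μ ?_ (Model.worstObs_isFiniteEntropy hP μ hV).1
    fun w => rfl
  simp only [worstObs_mul]
  have := S.measurable_nominalJoint P μ
  have := measurable_quadLoss (θ := θ) (S.measurable_update P μ)
  fun_prop

theorem Model.payoff_worstObs (hθ : 0 < θ) :
    S.payoff θ (gaussianDensity μ P) (S.worstObs θ P μ) (S.update P μ) =
      θ⁻¹ * Real.log (tiltConst θ (S.filtCov P)) := by
  rw [← (Model.worstObs_isFiniteEntropy hP μ hV).2, ← S.mul_payoff hP μ hθ,
    inv_mul_cancel_left₀ hθ.ne']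

theorem Model.payoff_update_le (hθ : 0 < θ) {φ : (Fin n → ℝ) → (Fin m → ℝ) → ℝ}
    (hφ : S.IsObsDensity (gaussianDensity μ P) φ) :
    S.payoff θ (gaussianDensity μ P) φ (S.update P μ) ≤
      θ⁻¹ * Real.log (tiltConst θ (S.filtCov P)) := by
  have hF := hφ.isFiniteEntropy hP μ
  rw [← div_eq_inv_mul, le_div_iff₀' hθ, S.mul_payoff hP μ hθ, ← S.integral_tilted hP μ hV]
  refine hF.integral_mul_sub_entropy_le (S.nominalJoint_pos hP μ) (S.integrable_tilted hP μ hV)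
    ?_ (S.integrable_quadLoss_mul hP μ hθ.le hF (S.measurable_update P μ)
      (S.integrable_sq_update_mul hP μ hF))
  rw [S.integral_tilted hP μ hV]
  exact tiltConst_pos (S.posDef_filtCov hP) hV

theorem Model.worstPayoff_update_le (hθ : 0 < θ) :
    S.worstPayoff θ (gaussianDensity μ P) (S.update P μ) ≤
      ((θ⁻¹ * Real.log (tiltConst θ (S.filtCov P)) : ℝ) : EReal) :=
  iSup_le fun φ => EReal.coe_le_coe_iff.mpr (Model.payoff_update_le hP μ hV hθ φ.2)

theorem Model.le_worstPayoff (hθ : 0 < θ) {g : (Fin m → ℝ) → Fin n → ℝ} (hg : Measurable g) :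
    ((θ⁻¹ * Real.log (tiltConst θ (S.filtCov P)) : ℝ) : EReal) ≤
      S.worstPayoff θ (gaussianDensity μ P) g := by
  by_contra! hlt
  -- A real r in between bounds all payoffs against g, and so the exponential cost, whatever
  -- extended value the supremum takes.
  obtain ⟨r, hr1, hr2⟩ := EReal.lt_iff_exists_real_btwn.mp hlt
  have hc := tiltConst_pos (S.posDef_filtCov hP) hV
  have h1 := Model.lintegral_exp_le_of_payoff_le hP μ hθ hg (r := r) fun φ hφ =>
    EReal.coe_le_coe_iff.mp ((le_iSup (fun φ : {φ // S.IsObsDensity (gaussianDensity μ P) φ} =>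
      ((S.payoff θ (gaussianDensity μ P) φ.1 g : ℝ) : EReal)) ⟨φ, hφ⟩).trans hr1.le)
  have h2 := (S.tiltConst_le_lintegral_exp_quadLoss hP μ hθ.le le_rfl hV hg).trans h1
  rw [ENNReal.ofReal_le_ofReal_iff (Real.exp_pos _).le, ← Real.log_le_iff_le_exp hc] at h2
  have h3 := EReal.coe_lt_coe_iff.mp hr2
  rw [← div_eq_inv_mul, lt_div_iff₀' hθ] at h3
  exact absurd h2 h3.not_ge

theorem Model.isMinimaxSolution_worstObs (hθ : 0 < θ) :
    S.IsMinimaxSolution θ (gaussianDensity μ P) (S.worstObs θ P μ) (S.update P μ) where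
  obsDensity := Model.isObsDensity_worstObs hP μ hV
  estimator := Model.isEstimator_update hP μ
  maximal φ' hφ' := by
    rw [Model.payoff_worstObs hP μ hV hθ]
    exact Model.payoff_update_le hP μ hV hθ hφ'
  minimal g' hg' := (Model.worstPayoff_update_le hP μ hV hθ).trans
    (Model.le_worstPayoff hP μ hV hθ hg'.measurable)

variable {μ} {φ : (Fin n → ℝ) → (Fin m → ℝ) → ℝ} {g : (Fin m → ℝ) → Fin n → ℝ}

/-- Minimality brings the cost of g down to `tiltConst`, so exp(θ‖g - x̂‖²/2) has mean at most one
under the law of y; being at least one, it is one almost everywhere. -/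
theorem Model.IsMinimaxSolution.estimator_ae_eq (hθ : 0 < θ)
    (h : S.IsMinimaxSolution θ (gaussianDensity μ P) φ g) : g =ᵐ[volume] S.update P μ := by
  have hc := tiltConst_pos (S.posDef_filtCov hP) hV
  have hg := h.estimator.measurable
  have h1 := Model.lintegral_exp_le_of_payoff_le hP μ hθ hg
    (r := θ⁻¹ * Real.log (tiltConst θ (S.filtCov P))) fun φ hφ =>
    EReal.coe_le_coe_iff.mp ((le_iSup (fun φ : {φ // S.IsObsDensity (gaussianDensity μ P) φ} =>
      ((S.payoff θ (gaussianDensity μ P) φ.1 g : ℝ) : EReal)) ⟨φ, hφ⟩).trans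
      ((h.minimal _ (Model.isEstimator_update hP μ)).trans
        (Model.worstPayoff_update_le hP μ hV hθ)))
  rw [mul_inv_cancel_left₀ hθ.ne', Real.exp_log hc] at h1
  have h2 := (S.le_lintegral_exp_quadLoss hP μ le_rfl hV hg).trans h1
  have hp := gaussianDensity_pos (S.posDef_innovCov hP) (S.C *ᵥ μ)
  have hpi : ∫⁻ y, ENNReal.ofReal (gaussianDensity (S.C *ᵥ μ) (S.innovCov P) y) = 1 := by
    rw [← ofReal_integral_eq_lintegral_ofReal (integrable_gaussianDensity (S.posDef_innovCov hP) _)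
      (.of_forall fun y => (hp y).le), integral_gaussianDensity (S.posDef_innovCov hP),
      ENNReal.ofReal_one]
  have hsq : ∀ y, 0 ≤ θ / 2 * ((g y - S.update P μ y) ⬝ᵥ (g y - S.update P μ y)) := fun y =>
    mul_nonneg (by positivity) (dotProduct_self_nonneg_real _)
  have hum := S.measurable_update P μ
  have h3 := ae_eq_of_ae_le_of_lintegral_le (μ := volume)
    (f := fun y => ENNReal.ofReal (gaussianDensity (S.C *ᵥ μ) (S.innovCov P) y))
    (g := fun y => ENNReal.ofReal (gaussianDensity (S.C *ᵥ μ) (S.innovCov P) y *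
        Real.exp (θ / 2 * ((g y - S.update P μ y) ⬝ᵥ (g y - S.update P μ y)))))
    (.of_forall fun y => ENNReal.ofReal_le_ofReal
      (le_mul_of_one_le_right (hp y).le (Real.one_le_exp (hsq y))))
    (by simp [hpi])
    (((measurable_gaussianDensity_comp _ (by fun_prop) (by fun_prop)).mul
      ((measurable_dotProduct_self (by fun_prop)).const_mul _).exp).ennreal_ofReal.aemeasurable)
    (by
      rw [hpi]
      refine (ENNReal.mul_le_mul_iff_right (a := ENNReal.ofReal (tiltConst θ (S.filtCov P)))
        (by simpa using hc) ENNReal.ofReal_ne_top).mp ?_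
      rwa [mul_one])
  filter_upwards [h3] with y hy
  rw [ENNReal.ofReal_eq_ofReal_iff (hp y).le (by have := hp y; positivity),
    left_eq_mul₀ (hp y).ne', Real.exp_eq_one_iff] at hy
  have h4 : (g y - S.update P μ y) ⬝ᵥ (g y - S.update P μ y) = 0 := by
    simpa [hθ.ne'] using hy
  exact sub_eq_zero.mp (dotProduct_self_eq_zero.mp h4)

/-- Against g, φ does at least as well as `worstObs`, which attains the Gibbs bound; the equality
case applies. -/
theorem Model.IsMinimaxSolution.joint_ae_eq (hθ : 0 < θ)
    (h : S.IsMinimaxSolution θ (gaussianDensity μ P) φ g) :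
    ∀ᵐ w : (Fin n → ℝ) × (Fin m → ℝ), φ w.1 w.2 * gaussianDensity μ P w.1 =
      S.worstObs θ P μ w.1 w.2 * gaussianDensity μ P w.1 := by
  have hg := h.estimator_ae_eq hP hV hθ
  have hF := h.obsDensity.isFiniteEntropy hP μ
  have h1 := h.maximal _ (Model.isObsDensity_worstObs hP μ hV)
  rw [Model.payoff_congr _ hg, Model.payoff_congr _ hg, Model.payoff_worstObs hP μ hV hθ, ← div_eq_inv_mul, div_le_iff₀' hθ,
    S.mul_payoff hP μ hθ, ← S.integral_tilted hP μ hV] at h1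
  have h2 := hF.ae_eq_of_le (S.nominalJoint_pos hP μ) (S.integrable_tilted hP μ hV)
    (by rw [S.integral_tilted hP μ hV]; exact tiltConst_pos (S.posDef_filtCov hP) hV)
    (S.integrable_quadLoss_mul hP μ hθ.le hF (S.measurable_update P μ)
      (S.integrable_sq_update_mul hP μ hF)) h1
  rw [S.integral_tilted hP μ hV] at h2
  filter_upwards [h2] with w hw
  rw [hw, worstObs_mul]

theorem Model.IsMinimaxSolution.obs_ae_eq (hθ : 0 < θ)
    (h : S.IsMinimaxSolution θ (gaussianDensity μ P) φ g) :
    ∀ᵐ w : (Fin n → ℝ) × (Fin m → ℝ), φ w.1 w.2 = S.worstObs θ P μ w.1 w.2 := by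
  filter_upwards [h.joint_ae_eq hP hV hθ] with w hw
  exact mul_right_cancel₀ (gaussianDensity_pos hP μ w.1).ne' hw

/-- Under the worst joint density the error x - x̂ is independent of y, so its covariance is the
same before and after conditioning. -/
theorem Model.IsMinimaxSolution.errorCov_eq (hθ : 0 < θ)
    (h : S.IsMinimaxSolution θ (gaussianDensity μ P) φ g) :
    errorCov (gaussianDensity μ P) φ g = S.riskCov θ P := by
  have hg : ∀ᵐ w : (Fin n → ℝ) × (Fin m → ℝ), g w.2 = S.update P μ w.2 := by
    rw [Measure.volume_eq_prod]
    exact Measure.quasiMeasurePreserving_snd.ae (h.estimator_ae_eq hP hV hθ)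
  have hV' : (S.riskCov θ P).PosDef := hV.inv
  ext i j
  have e := integral_shear (integrable_gaussianDensity (S.posDef_innovCov hP) (S.C *ᵥ μ))
    (f := fun u => u i * u j * gaussianDensity 0 (S.riskCov θ P) u)
    ((by fun_prop : Measurable fun u : Fin n → ℝ => u i * u j).mul
      (measurable_gaussianDensity_comp _ (by fun_prop) (by fun_prop)))
    (by simpa using integrable_sub_mul_sub_mul_gaussianDensity hV' 0 i j) (S.measurable_update P μ)
  have e2 := integral_sub_mul_sub_mul_gaussianDensity hV' 0 i j
  simp only [Pi.zero_apply, sub_zero] at e2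
  rw [integral_gaussianDensity (S.posDef_innovCov hP), one_mul, e2] at e
  rw [← e, errorCov, Matrix.of_apply]
  refine integral_congr_ae ?_
  filter_upwards [hg, h.joint_ae_eq hP hV hθ] with w h1 h2
  rw [h1, h2, Model.worstObs_mul_eq hP μ hV]
  simp only [Pi.sub_apply]
  ring

theorem Model.posterior_ae_eq {y : Fin m → ℝ}
    (h : ∀ᵐ x, φ x y = S.worstObs θ P μ x y) :
    posterior (gaussianDensity μ P) φ y =ᵐ[volume]
      gaussianDensity (S.update P μ y) (S.riskCov θ P) := by
  have hV' : (S.riskCov θ P).PosDef := hV.inv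
  have h1 : ∀ᵐ x, φ x y * gaussianDensity μ P x =
      gaussianDensity (S.C *ᵥ μ) (S.innovCov P) y *
        gaussianDensity (S.update P μ y) (S.riskCov θ P) x := by
    filter_upwards [h] with x hx
    rw [hx, Model.worstObs_mul_eq hP μ hV (x, y), gaussianDensity_eq_zero_mean (S.update P μ y)]
  have h2 : ∫ z, φ z y * gaussianDensity μ P z = gaussianDensity (S.C *ᵥ μ) (S.innovCov P) y := by
    rw [integral_congr_ae h1, integral_const_mul, integral_gaussianDensity hV', mul_one]
  filter_upwards [h1] with x hx
  rw [posterior, h2, hx,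
    mul_div_cancel_left₀ _ (gaussianDensity_pos (S.posDef_innovCov hP) _ _).ne']

end Subcritical

end Solution

/-! ### The dynamic game: propagation of the Gaussian prior. -/

section Dynamics

variable {n m : ℕ}

theorem ae_of_ae_init_last {Y : Type*} [MeasureSpace Y] [SigmaFinite (volume : Measure Y)] {t : ℕ}
    {p : (Fin t → Y) × Y → Prop} (h : ∀ᵐ z, p z) :
    ∀ᵐ h : Fin (t + 1) → Y, p (Fin.init h, h (Fin.last t)) := by
  have h1 := volume_preserving_piFinSuccAbove (fun _ : Fin (t + 1) => Y) (Fin.last t)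
  have h2 : MeasurePreserving (Prod.swap : Y × (Fin t → Y) → (Fin t → Y) × Y)
      volume volume := Measure.measurePreserving_swap
  filter_upwards [(h2.comp h1).quasiMeasurePreserving.ae h] with z hz
  simpa [Fin.removeNth_last] using hz

/-- The game determines the density for almost every (x, y), while the posterior needs almost every
x at a fixed history and observation. -/
theorem ae_ae_of_ae_prod_prod {X Y H : Type*} [MeasureSpace X] [MeasureSpace Y] [MeasureSpace H]
    [SFinite (volume : Measure X)] [SFinite (volume : Measure Y)] [SFinite (volume : Measure H)]
    {p : H × X × Y → Prop} (h : ∀ᵐ z, p z) : ∀ᵐ z : H × Y, ∀ᵐ x : X, p (z.1, x, z.2) := by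
  have h1 : MeasurePreserving (MeasurableEquiv.prodAssoc : (H × Y) × X ≃ᵐ H × Y × X)
      volume volume := volume_preserving_prodAssoc
  have h2 : MeasurePreserving (Prod.map id Prod.swap : H × Y × X → H × X × Y)
      volume volume :=
    (MeasurePreserving.id volume).prod Measure.measurePreserving_swap
  exact Measure.ae_ae_of_ae_prod ((h2.comp h1).quasiMeasurePreserving.ae h)

/-- The prediction step seen as an observation step: `x_{t+1}` is a noisy observation of `x_t`. -/
noncomputable def Model.prediction (S : Model n m) : Model n n where
  A := S.A
  Q := S.Q
  C := S.A
  R := S.Q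
  x0 := S.x0
  P0 := S.P0
  posDef_Q := S.posDef_Q
  posDef_R := S.posDef_Q
  posDef_P0 := S.posDef_P0

variable (S : Model n m) {θ : ℝ}

/-- Bayes' rule for `Model.prediction`: the conditional density of x_t integrates to one and the law
of x_{t+1} remains. -/
theorem Model.integral_transition_mul {V : Matrix (Fin n) (Fin n) ℝ} (hV : V.PosDef)
    (μ x' : Fin n → ℝ) : ∫ x, S.transition x x' * gaussianDensity μ V x =
      gaussianDensity (S.A *ᵥ μ) (S.A * V * S.Aᵀ + S.Q) x' := by
  have h : ∀ x, S.transition x x' * gaussianDensity μ V x =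
      gaussianDensity (S.A *ᵥ μ) (S.A * V * S.Aᵀ + S.Q) x' *
        gaussianDensity (S.prediction.update V μ x') (S.prediction.filtCov V) x :=
    fun x => S.prediction.nominalObs_mul_gaussianDensity hV μ x x'
  simp only [h]
  rw [integral_const_mul, integral_gaussianDensity (S.prediction.posDef_filtCov hV), mul_one]

variable {ψ : (t : ℕ) → (Fin t → Fin m → ℝ) → (Fin n → ℝ) → (Fin m → ℝ) → ℝ}
  {g : (t : ℕ) → (Fin t → Fin m → ℝ) → (Fin m → ℝ) → (Fin n → ℝ)} {t N : ℕ}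

/-- The posterior enters only under an integral, so knowing it almost everywhere fixes the next
prior at every point. -/
theorem Model.prior_succ_eq (hV : (S.riskCov θ (S.predCov θ t)).PosDef)
    {h : Fin (t + 1) → Fin m → ℝ}
    (hpost : posterior (S.prior ψ t (Fin.init h)) (ψ t (Fin.init h)) (h (Fin.last t))
      =ᵐ[volume] gaussianDensity (S.filtMean θ t h) (S.riskCov θ (S.predCov θ t))) :
    S.prior ψ (t + 1) h =
      gaussianDensity (S.predMean θ (t + 1) h) (S.predCov θ (t + 1)) := by
  ext x'
  refine Eq.trans (integral_congr_ae ?_) (S.integral_transition_mul hV (S.filtMean θ t h) x')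
  filter_upwards [hpost] with x hx
  rw [hx]

theorem Model.continuous_predMean (θ : ℝ) : ∀ t, Continuous (S.predMean (m := m) θ t)
  | 0 => continuous_const
  | t + 1 => by
    have ih := Model.continuous_predMean θ t
    have h : Continuous fun h : Fin (t + 1) → Fin m → ℝ =>
        S.update (S.predCov θ t) (S.predMean θ t (Fin.init h)) (h (Fin.last t)) :=
      (S.continuous_update (S.predCov θ t)).comp
        ((ih.comp (by unfold Fin.init; fun_prop)).prodMk (continuous_apply _))
    exact (by fun_prop : Continuous fun v : Fin n → ℝ => S.A *ᵥ v).comp h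

theorem Model.measurable_worstObs_predMean (θ : ℝ) (t : ℕ) :
    Measurable fun p : (Fin t → Fin m → ℝ) × (Fin n → ℝ) × (Fin m → ℝ) =>
      S.worstObs θ (S.predCov θ t) (S.predMean θ t p.1) p.2.1 p.2.2 := by
  have h1 := (S.continuous_predMean θ t).measurable
  have h2 : Measurable fun p : (Fin t → Fin m → ℝ) × (Fin n → ℝ) × (Fin m → ℝ) =>
      S.update (S.predCov θ t) (S.predMean θ t p.1) p.2.2 :=
    (S.continuous_update (S.predCov θ t)).measurable.comp
      ((h1.comp measurable_fst).prodMk (by fun_prop))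
  unfold worstObs quadLoss nominalObs
  exact ((measurable_gaussianDensity_comp _ (by fun_prop) (by fun_prop)).mul
    (((measurable_dotProduct_self ((measurable_fst.comp measurable_snd).sub h2)).const_mul _).exp)).const_mul _

theorem Model.measurable_update_predMean (θ : ℝ) (t : ℕ) :
    Measurable fun p : (Fin t → Fin m → ℝ) × (Fin m → ℝ) =>
      S.update (S.predCov θ t) (S.predMean θ t p.1) p.2 :=
  (S.continuous_update (S.predCov θ t)).measurable.comp
    (((S.continuous_predMean θ t).measurable.comp measurable_fst).prodMk measurable_snd)

theorem Model.posDef_predCov_succ (hV : (S.riskCov θ (S.predCov θ t)).PosDef) :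
    (S.predCov θ (t + 1)).PosDef :=
  S.prediction.posDef_innovCov hV

section

variable {S} (hsol : S.IsRiskSensitiveSolution θ N ψ g) (hθ : 0 < θ) (ht : t ≤ N)
  (hP : (S.predCov θ t).PosDef)
  (hprior : ∀ᵐ h : Fin t → Fin m → ℝ,
    S.prior ψ t h = gaussianDensity (S.predMean θ t h) (S.predCov θ t))

include hsol ht hprior in
theorem Model.IsRiskSensitiveSolution.ae_isMinimaxSolution :
    ∀ᵐ h : Fin t → Fin m → ℝ, S.IsMinimaxSolution θ
      (gaussianDensity (S.predMean θ t h) (S.predCov θ t)) (ψ t h) (g t h) := by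
  filter_upwards [hsol.minimax t ht, hprior] with h h1 h2
  rwa [← h2]

include hsol hθ ht hP hprior

theorem Model.IsRiskSensitiveSolution.sigmaMax_lt :
    θ * sigmaMax (S.filtCov (S.predCov θ t)) < 1 := by
  -- The inequality does not involve the history, so one good history suffices.
  obtain ⟨h, hh⟩ := (hsol.ae_isMinimaxSolution ht hprior).exists
  exact hh.sigmaMax_lt hP hθ

theorem Model.IsRiskSensitiveSolution.posDef_inv_sub :
    ((S.filtCov (S.predCov θ t))⁻¹ - θ • (1 : Matrix (Fin n) (Fin n) ℝ)).PosDef :=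
  posDef_inv_sub_of_sigmaMax_lt (S.posDef_filtCov hP) hθ (hsol.sigmaMax_lt hθ ht hP hprior)

theorem Model.IsRiskSensitiveSolution.ae_estimator_eq :
    ∀ᵐ h : Fin (t + 1) → Fin m → ℝ,
      g t (Fin.init h) (h (Fin.last t)) = S.filtMean θ t h := by
  have hV := hsol.posDef_inv_sub hθ ht hP hprior
  refine ae_of_ae_init_last
    (p := fun z => g t z.1 z.2 = S.update (S.predCov θ t) (S.predMean θ t z.1) z.2) ?_
  -- Joint measurability in the history and y merges the iterated almost everywhere statements into
  -- one on the product.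
  rw [Measure.volume_eq_prod, Measure.ae_prod_iff_ae_ae
    (measurableSet_eq_fun (hsol.measurable_est t ht) (S.measurable_update_predMean θ t))]
  filter_upwards [hsol.ae_isMinimaxSolution ht hprior] with h hh
  exact hh.estimator_ae_eq hP hV hθ

theorem Model.IsRiskSensitiveSolution.ae_posterior_ae_eq :
    ∀ᵐ h : Fin (t + 1) → Fin m → ℝ,
      posterior (S.prior ψ t (Fin.init h)) (ψ t (Fin.init h)) (h (Fin.last t))
        =ᵐ[volume] gaussianDensity (S.filtMean θ t h) (S.riskCov θ (S.predCov θ t)) := by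
  have hV := hsol.posDef_inv_sub hθ ht hP hprior
  have h1 : ∀ᵐ p : (Fin t → Fin m → ℝ) × (Fin n → ℝ) × (Fin m → ℝ), ψ t p.1 p.2.1 p.2.2 =
      S.worstObs θ (S.predCov θ t) (S.predMean θ t p.1) p.2.1 p.2.2 := by
    rw [Measure.volume_eq_prod, Measure.ae_prod_iff_ae_ae
      (measurableSet_eq_fun (hsol.measurable_obs t ht) (S.measurable_worstObs_predMean θ t))]
    filter_upwards [hsol.ae_isMinimaxSolution ht hprior] with h hh
    exact hh.obs_ae_eq hP hV hθ
  have h2 := ae_of_ae_init_last (ae_ae_of_ae_prod_prod h1)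
  have h3 : ∀ᵐ z : (Fin t → Fin m → ℝ) × (Fin m → ℝ),
      S.prior ψ t z.1 = gaussianDensity (S.predMean θ t z.1) (S.predCov θ t) := by
    rw [Measure.volume_eq_prod]
    exact Measure.quasiMeasurePreserving_fst.ae hprior
  filter_upwards [h2, ae_of_ae_init_last h3] with h h4 h5
  rw [h5]
  exact Model.posterior_ae_eq hP hV h4

theorem Model.IsRiskSensitiveSolution.ae_prior_succ_eq :
    ∀ᵐ h : Fin (t + 1) → Fin m → ℝ, S.prior ψ (t + 1) h =
      gaussianDensity (S.predMean θ (t + 1) h) (S.predCov θ (t + 1)) := by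
  filter_upwards [hsol.ae_posterior_ae_eq hθ ht hP hprior] with h hh
  exact S.prior_succ_eq (hsol.posDef_inv_sub hθ ht hP hprior).inv hh

end

/-- Both claims are carried together: positivity of P_{t+1} needs the eigenvalue bound at time t,
which solvability yields once the prior is Gaussian. -/
theorem Model.IsRiskSensitiveSolution.prior_ae_eq {S : Model n m}
    (hsol : S.IsRiskSensitiveSolution θ N ψ g) (hθ : 0 < θ) : ∀ t ≤ N,
    (S.predCov θ t).PosDef ∧ ∀ᵐ h : Fin t → Fin m → ℝ,
      S.prior ψ t h = gaussianDensity (S.predMean θ t h) (S.predCov θ t)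
  | 0, _ => ⟨S.posDef_P0, .of_forall fun _ => rfl⟩
  | t + 1, ht => by
    obtain ⟨h1, h2⟩ := hsol.prior_ae_eq hθ t (by omega)
    exact ⟨S.posDef_predCov_succ (hsol.posDef_inv_sub hθ (by omega) h1 h2).inv,
      hsol.ae_prior_succ_eq hθ (by omega) h1 h2⟩

/-- For the explicit densities the identities hold at every history, with no exceptional null set.
-/
theorem Model.prior_worstObs_eq (hθ : 0 < θ)
    (hN : ∀ t ≤ N, θ * sigmaMax (S.filtCov (S.predCov θ t)) < 1) : ∀ t ≤ N,
    (S.predCov θ t).PosDef ∧ ∀ h : Fin t → Fin m → ℝ,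
      S.prior (fun t h => S.worstObs θ (S.predCov θ t) (S.predMean θ t h)) t h =
        gaussianDensity (S.predMean θ t h) (S.predCov θ t)
  | 0, _ => ⟨S.posDef_P0, fun _ => rfl⟩
  | t + 1, ht => by
    obtain ⟨hP, hprior⟩ := Model.prior_worstObs_eq hθ hN t (by omega)
    have hV := posDef_inv_sub_of_sigmaMax_lt (S.posDef_filtCov hP) hθ (hN t (by omega))
    refine ⟨S.posDef_predCov_succ hV.inv, fun h => S.prior_succ_eq hV.inv ?_⟩
    rw [hprior]
    exact Model.posterior_ae_eq hP hV (.of_forall fun _ => rfl)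

theorem Model.isRiskSensitiveSolution_worstObs (hθ : 0 < θ)
    (hN : ∀ t ≤ N, θ * sigmaMax (S.filtCov (S.predCov θ t)) < 1) :
    S.IsRiskSensitiveSolution θ N (fun t h => S.worstObs θ (S.predCov θ t) (S.predMean θ t h))
      (fun t h => S.update (S.predCov θ t) (S.predMean θ t h)) where
  measurable_obs t _ := S.measurable_worstObs_predMean θ t
  measurable_est t _ := S.measurable_update_predMean θ t
  minimax t ht := .of_forall fun h => by
    obtain ⟨hP, hprior⟩ := S.prior_worstObs_eq hθ hN t ht
    rw [hprior]
    exact Model.isMinimaxSolution_worstObs hP _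
      (posDef_inv_sub_of_sigmaMax_lt (S.posDef_filtCov hP) hθ (hN t ht)) hθ

end Dynamics

/-! ### Assembly of the theorem. -/

theorem densityCov_congr {k : ℕ} {ρ ρ' : (Fin k → ℝ) → ℝ} (h : ρ =ᵐ[volume] ρ')
    (μ : Fin k → ℝ) : densityCov ρ μ = densityCov ρ' μ := by
  ext i j
  refine integral_congr_ae ?_
  filter_upwards [h] with x hx
  rw [hx]

end RiskSensitive

theorem theorem4 {n m : ℕ} (S : RiskSensitive.Model n m) (θ : ℝ) (hθ : 0 < θ) (N : ℕ) :
    ((∃ ψ g, S.IsRiskSensitiveSolution θ N ψ g) ↔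
      ∀ t ≤ N, θ * RiskSensitive.sigmaMax (S.filtCov (S.predCov θ t)) < 1) ∧
    ∀ ψ g, S.IsRiskSensitiveSolution θ N ψ g → ∀ t ≤ N,
      (S.predCov θ t).PosDef ∧
      (S.filtCov (S.predCov θ t)).PosDef ∧
      (S.riskCov θ (S.predCov θ t)).PosDef ∧
      (S.predCov θ (t + 1)).PosDef ∧
      (∀ᵐ h : Fin t → Fin m → ℝ,
        RiskSensitive.errorCov (S.prior ψ t h) (ψ t h) (g t h) =
          S.riskCov θ (S.predCov θ t)) ∧
      ∀ᵐ h : Fin (t + 1) → Fin m → ℝ,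
        g t (Fin.init h) (h (Fin.last t)) = S.filtMean θ t h ∧
        RiskSensitive.posterior (S.prior ψ t (Fin.init h)) (ψ t (Fin.init h)) (h (Fin.last t))
          =ᵐ[volume] RiskSensitive.gaussianDensity (S.filtMean θ t h)
            (S.riskCov θ (S.predCov θ t)) ∧
        RiskSensitive.densityCov
          (RiskSensitive.posterior (S.prior ψ t (Fin.init h)) (ψ t (Fin.init h)) (h (Fin.last t)))
          (S.filtMean θ t h) = S.riskCov θ (S.predCov θ t) ∧
        S.prior ψ (t + 1) h =
          RiskSensitive.gaussianDensity (S.predMean θ (t + 1) h) (S.predCov θ (t + 1)) ∧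
        RiskSensitive.densityMean (S.prior ψ (t + 1) h) = S.A *ᵥ S.filtMean θ t h ∧
        RiskSensitive.densityCov (S.prior ψ (t + 1) h) (S.A *ᵥ S.filtMean θ t h) =
          S.A * S.riskCov θ (S.predCov θ t) * S.Aᵀ + S.Q := by
  refine ⟨⟨?_, fun hN => ⟨_, _, S.isRiskSensitiveSolution_worstObs hθ hN⟩⟩, ?_⟩
  · rintro ⟨ψ, g, hsol⟩ t ht
    obtain ⟨hP, hprior⟩ := hsol.prior_ae_eq hθ t ht
    exact hsol.sigmaMax_lt hθ ht hP hprior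
  · intro ψ g hsol t ht
    obtain ⟨hP, hprior⟩ := hsol.prior_ae_eq hθ t ht
    have hM := hsol.posDef_inv_sub hθ ht hP hprior
    have hV : (S.riskCov θ (S.predCov θ t)).PosDef := hM.inv
    have hP' := S.posDef_predCov_succ hV
    refine ⟨hP, S.posDef_filtCov hP, hV, hP', ?_, ?_⟩
    · filter_upwards [hsol.ae_isMinimaxSolution ht hprior, hprior] with h h1 h2
      rw [h2]
      exact h1.errorCov_eq hP hM hθ
    · filter_upwards [hsol.ae_estimator_eq hθ ht hP hprior,
        hsol.ae_posterior_ae_eq hθ ht hP hprior,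
        hsol.ae_prior_succ_eq hθ ht hP hprior] with h h1 h2 h3
      refine ⟨h1, h2, ?_, h3, ?_, ?_⟩
      · rw [RiskSensitive.densityCov_congr h2, RiskSensitive.densityCov_gaussianDensity hV]
      · rw [h3, RiskSensitive.densityMean_gaussianDensity hP']
        rfl
      · rw [h3]
        exact RiskSensitive.densityCov_gaussianDensity hP' _
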